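/- **Conventions.** Let $\Bbbk$ be $\mathbb{R}$ or $\mathbb{C}$ (the main case is $\mathbb{C}$) and let $V$ be a finite-dimensional $\Bbbk$-vector space. A *connection* on a smooth $\Bbbk$-vector bundle $E\to M$ is a $\Bbbk$-linear map $\nabla:\Gamma(E)\to\Gamma(E\otimes T^*M)$ with $\nabla(rs)=r\nabla s+s\otimes dr$ for all $r\in C^\infty(M,\Bbbk)$. A *bundle cobordism* from $W_0$ to $W_1$ with fibre $V$ is a smooth $\Bbbk$-vector bundle $E\to M$ with fibre $V$ over a compact smooth manifold $M$ (boundary and corners are allowed), together with collars, i.e. diffeomorphisms from $W_0\times[0,1)$ and $W_1\times(-1,0]$ onto disjoint open subsets of $M$, where $W_0,W_1$ are compact smooth manifolds (the incoming and outgoing boundary of $M$), and a smooth $\Bbbk$-linear trivialization of $E$ over the union $C$ of the two collars (the *trivialized boundary collar*). A *bump function* for it is a smooth $f:M\to[0,1]$ that vanishes near the incoming and outgoing boundary and equals $1$ near $M\setminus C$. On $C$, write $\nabla=d+A_\nabla$, where $d$ is the exterior derivative in the given trivialization. If $E\to M$ is a bundle cobordism from $W_0$ to $W_1$ and $E'\to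 M'$ is one from $W_1$ to $W_2$, with the same fibre $V$, their *gluing* $E'*E\to M'*M$ is obtained by identifying the outgoing boundary of $M$ with the incoming boundary of $M'$ through $W_1$, and the fibres over it through the trivializations; its smooth structure is the one for which $M$ without its outgoing boundary, $M'$ without its incoming boundary, and the bicollar $W_1\times(-1,1)$ (with the trivial bundle over it) are included as open submanifolds with bundles. **Theorem.** Let $E\to M$ and $E'\to M'$ be bundle cobordisms with gluing $E'*E\to M'*M$, and let $\nabla$ and $\nabla'$ be connections on $E$ and $E'$. Then bump functions $f$ on $M$ and $f'$ on $M'$ exist, and for any such $f,f'$ there is a connection $$\nabla'*\nabla=d+f\cdot A_\nabla+f'\cdot A_{\nabla'}$$ on $E'*E$ ($f$ and $f'$ being extended by zero to $M'$ and $M$), in the following sense. Let $\sigma$ be a section of $E'*E$ that agrees near a point $x\in M$ with a section $s$ of $E$. If $x\in C$, then $(\nabla'*\nabla)\sigma$ at $x$ equals $ds+f\cdot A_\nabla s$ at $x$; if $x\notin C$, it equals $\nabla s$ at $x$. The same holds on $M'$ with $E',\nabla',f'$ and the collar $C'$ of $E'$. In particular, $\nabla'*\nabla$ has the same output as $\nabla$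 (respectively $\nabla'$) on local sections of $E$ (respectively $E'$) defined away from the trivialized boundary collar. -/

import Mathlib

open Set Filter Topology Bundle
open scoped Manifold ContDiff

noncomputable section

namespace BundleGlue

section Diffeo

variable {E₁ : Type*} [NormedAddCommGroup E₁] [NormedSpace ℝ E₁] {H₁ : Type*} [TopologicalSpace H₁]
  (I₁ : ModelWithCorners ℝ E₁ H₁) {X : Type*} [TopologicalSpace X] [ChartedSpace H₁ X]
  {E₂ : Type*} [NormedAddCommGroup E₂] [NormedSpace ℝ E₂] {H₂ : Type*} [TopologicalSpace H₂]
  (I₂ : ModelWithCorners ℝ E₂ H₂) {Y : Type*} [TopologicalSpace Y] [ChartedSpace H₂ Y]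

/-- `g` restricts to a diffeomorphism from the subset `s` of `X` onto an open subset of `Y`.
(The clause `s.Nonempty` only matters if `X` is empty, when there is no function `Y → X`.) -/
def IsOpenDiffeoOn (g : X → Y) (s : Set X) : Prop :=
  ContMDiffOn I₁ I₂ ∞ g s ∧ IsOpen (g '' s) ∧
    (s.Nonempty → ∃ h : Y → X, ContMDiffOn I₂ I₁ ∞ h (g '' s) ∧ LeftInvOn h g s)

end Diffeo

section Connection

variable {EM : Type*} [NormedAddCommGroup EM] [NormedSpace ℝ EM]
  {HM : Type*} [TopologicalSpace HM] (J : ModelWithCorners ℝ EM HM)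
  {M : Type*} [TopologicalSpace M] [ChartedSpace HM M] [IsManifold J ∞ M]
  (V : Type*) [NormedAddCommGroup V] [NormedSpace ℝ V]
  (E : M → Type*) [TopologicalSpace (TotalSpace V E)] [∀ x, TopologicalSpace (E x)]
  [∀ x, AddCommGroup (E x)] [∀ x, Module ℝ (E x)]
  [FiberBundle V E]

/-- The smooth sections `Γ(E)`. -/
abbrev Sec := ContMDiffSection J V ∞ E

variable [VectorBundle ℝ V E] [∀ x, IsTopologicalAddGroup (E x)] [∀ x, ContinuousSMul ℝ (E x)]

/-- The smooth sections of `E ⊗ T*M = Hom_ℝ(TM, E)`. -/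
abbrev FormSec :=
  ContMDiffSection J (EM →L[ℝ] V) ∞ (fun x : M ↦ TangentSpace J x →L[ℝ] E x)

variable (𝕜 : Type*) [RCLike 𝕜] [∀ x, Module 𝕜 (E x)]

/-- A connection on the `𝕜`-vector bundle `E → M`: a map `∇ : Γ(E) → Γ(E ⊗ T*M)` that is
`𝕜`-linear and satisfies `∇(r s) = r ∇s + s ⊗ dr` for all smooth `r : M → 𝕜`.
Here `t = r s` is written pointwise. -/
structure Connection where
  /-- the operator -/
  toFun : Sec J V E → FormSec J V E
  map_add : ∀ s t, toFun (s + t) = toFun s + toFun t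
  map_smul : ∀ (c : 𝕜) (s t : Sec J V E), (∀ x, t x = c • s x) →
    ∀ x (v : TangentSpace J x), toFun t x v = c • toFun s x v
  leibniz : ∀ r : M → 𝕜, ContMDiff J 𝓘(ℝ, 𝕜) ∞ r → ∀ s t : Sec J V E, (∀ x, t x = r x • s x) →
    ∀ x (v : TangentSpace J x),
      toFun t x v = r x • toFun s x v + (show 𝕜 from mfderiv J 𝓘(ℝ, 𝕜) r x v) • s x

variable {J V E 𝕜}

/-- The exterior derivative `d` of a section in a trivialization `e` (meaningful over the base set
of `e`): `d s` evaluated at the tangent vector `v` at `x`. -/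
def trivialD (e : Trivialization V (π V E)) (s : Sec J V E) (x : M) (v : TangentSpace J x) : E x :=
  e.symm x (show V from mfderiv J 𝓘(ℝ, V) (fun y ↦ (e ⟨y, s y⟩).2) x v)

/-- The connection form `A_∇ = ∇ - d` in a trivialization. -/
def Connection.form (D : Connection J V E 𝕜) (e : Trivialization V (π V E))
    (s : Sec J V E) (x : M) (v : TangentSpace J x) : E x :=
  D.toFun s x v - trivialD e s x v

/-- The operator `f · ∇ = d + f · A_∇` in a trivialization. -/
def Connection.scaled (D : Connection J V E 𝕜) (e : Trivialization V (π V E)) (f : M → ℝ)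
    (s : Sec J V E) (x : M) (v : TangentSpace J x) : E x :=
  trivialD e s x v + f x • D.form e s x v

end Connection

section Cobordism

variable {EW : Type*} [NormedAddCommGroup EW] [NormedSpace ℝ EW]
  {HW : Type*} [TopologicalSpace HW] (IW : ModelWithCorners ℝ EW HW)
  (W₀ : Type*) [TopologicalSpace W₀] [ChartedSpace HW W₀]
  (W₁ : Type*) [TopologicalSpace W₁] [ChartedSpace HW W₁]
  {EM : Type*} [NormedAddCommGroup EM] [NormedSpace ℝ EM]
  {HM : Type*} [TopologicalSpace HM] (J : ModelWithCorners ℝ EM HM)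
  {M : Type*} [TopologicalSpace M] [ChartedSpace HM M]
  (𝕜 : Type*) [RCLike 𝕜]
  (V : Type*) [NormedAddCommGroup V] [NormedSpace ℝ V] [NormedSpace 𝕜 V]
  (E : M → Type*) [TopologicalSpace (TotalSpace V E)] [∀ x, TopologicalSpace (E x)]
  [∀ x, AddCommGroup (E x)] [∀ x, Module 𝕜 (E x)]
  [FiberBundle V E]

/-- The structure of a bundle cobordism from `W₀ × V` to `W₁ × V` on a vector bundle `E → M`:
collars `W₀ × [0, 1) → M` and `W₁ × (-1, 0] → M`, which are diffeomorphisms onto disjoint open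
subsets of `M` (so that `W₀ × {0}` and `W₁ × {0}` are the incoming and the outgoing part of the
boundary of `M`), and a smooth `𝕜`-linear trivialization of `E` over the union of the two collars.
`M` may have further free boundary, and `W₀`, `W₁` may have boundary themselves (thick tangles); for
ordinary cobordisms `W₀` and `W₁` are closed and exhaust the boundary of `M`.
The values of `inC` and `outC` outside the indicated sets are irrelevant. -/
structure BundleCobordism where
  /-- the collar of the incoming boundary -/
  inC : W₀ × ℝ → M
  /-- the collar of the outgoing boundary -/
  outC : W₁ × ℝ → M
  inC_diffeo : IsOpenDiffeoOn (IW.prod 𝓘(ℝ, ℝ)) J inC (univ ×ˢ Ico 0 1)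
  outC_diffeo : IsOpenDiffeoOn (IW.prod 𝓘(ℝ, ℝ)) J outC (univ ×ˢ Ioc (-1) 0)
  disjoint : Disjoint (inC '' (univ ×ˢ Ico 0 1)) (outC '' (univ ×ˢ Ioc (-1) 0))
  /-- the trivialization over the collars -/
  triv : Trivialization V (π V E)
  triv_linear : triv.IsLinear 𝕜
  triv_baseSet : triv.baseSet = inC '' (univ ×ˢ Ico 0 1) ∪ outC '' (univ ×ˢ Ioc (-1) 0)
  triv_smooth : ContMDiffOn (J.prod 𝓘(ℝ, V)) (J.prod 𝓘(ℝ, V)) ∞ triv triv.source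
  triv_symm_smooth : ContMDiffOn (J.prod 𝓘(ℝ, V)) (J.prod 𝓘(ℝ, V)) ∞
    triv.toOpenPartialHomeomorph.symm triv.target

variable {IW W₀ W₁ J 𝕜 V E}

/-- The trivialized boundary collar. -/
def BundleCobordism.collar (c : BundleCobordism IW W₀ W₁ J 𝕜 V E) : Set M :=
  c.inC '' (univ ×ˢ Ico 0 1) ∪ c.outC '' (univ ×ˢ Ioc (-1) 0)

/-- The incoming boundary. -/
def BundleCobordism.inBdry (c : BundleCobordism IW W₀ W₁ J 𝕜 V E) : Set M :=
  range fun w ↦ c.inC (w, 0)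

/-- The outgoing boundary. -/
def BundleCobordism.outBdry (c : BundleCobordism IW W₀ W₁ J 𝕜 V E) : Set M :=
  range fun w ↦ c.outC (w, 0)

/-- `f` is a bump function for the collar: smooth, with values in `[0, 1]`, equal to `0` near
the (incoming and outgoing) boundary and to `1` near the complement of the collar. -/
structure BundleCobordism.IsBump (c : BundleCobordism IW W₀ W₁ J 𝕜 V E) (f : M → ℝ) : Prop where
  smooth : ContMDiff J 𝓘(ℝ, ℝ) ∞ f
  mem_Icc : ∀ x, f x ∈ Icc (0 : ℝ) 1
  eq_zero : ∀ x ∈ c.inBdry ∪ c.outBdry, ∀ᶠ y in 𝓝 x, f y = 0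
  eq_one : ∀ x ∉ c.collar, ∀ᶠ y in 𝓝 x, f y = 1

variable {W₂ : Type*} [TopologicalSpace W₂] [ChartedSpace HW W₂]
  {EM' : Type*} [NormedAddCommGroup EM'] [NormedSpace ℝ EM']
  {HM' : Type*} [TopologicalSpace HM'] {J' : ModelWithCorners ℝ EM' HM'}
  {M' : Type*} [TopologicalSpace M'] [ChartedSpace HM' M']
  {E' : M' → Type*} [TopologicalSpace (TotalSpace V E')] [∀ x, TopologicalSpace (E' x)]
  [∀ x, AddCommGroup (E' x)] [∀ x, Module 𝕜 (E' x)]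
  [FiberBundle V E']
  {EN : Type*} [NormedAddCommGroup EN] [NormedSpace ℝ EN]
  {HN : Type*} [TopologicalSpace HN] (JN : ModelWithCorners ℝ EN HN)
  {N : Type*} [TopologicalSpace N] [ChartedSpace HN N]
  (F : N → Type*) [TopologicalSpace (TotalSpace V F)] [∀ x, TopologicalSpace (F x)]
  [∀ x, AddCommGroup (F x)] [∀ x, Module 𝕜 (F x)]
  [FiberBundle V F]

/-- `F → N` is the gluing `E' * E → M' * M` of bundle cobordisms `E → M` from `W₀` to `W₁` and
`E' → M'` from `W₁` to `W₂`.

As a set `N` is the pushout of `M ← W₁ → M'`. The topology and the smooth structure of `N` are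
those for which `M` without its outgoing boundary, `M'` without its incoming boundary, and the
bicollar `W₁ × (-1, 1)`, assembled from the two collars, are embedded diffeomorphically onto open
subsets. The fibres of `F` over `M` and `M'` are those of `E` and `E'`, identified over `W₁` through
the two trivializations, and the bundle structure of `F` is the one for which the same three
embeddings are covered by bundle isomorphisms, with the trivial bundle over the bicollar.
These conditions determine `F → N` up to a unique isomorphism under `E` and `E'`. -/
structure BundleGluing (c : BundleCobordism IW W₀ W₁ J 𝕜 V E)
    (c' : BundleCobordism IW W₁ W₂ J' 𝕜 V E') where
  /-- the inclusion of `M` -/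
  inl : M → N
  /-- the inclusion of `M'` -/
  inr : M' → N
  inl_injective : inl.Injective
  inr_injective : inr.Injective
  range_union : range inl ∪ range inr = univ
  inl_eq_inr_iff : ∀ x x', inl x = inr x' ↔ ∃ w, x = c.outC (w, 0) ∧ x' = c'.inC (w, 0)
  inl_diffeo : IsOpenDiffeoOn J JN inl c.outBdryᶜ
  inr_diffeo : IsOpenDiffeoOn J' JN inr c'.inBdryᶜ
  neck_diffeo : IsOpenDiffeoOn (IW.prod 𝓘(ℝ, ℝ)) JN
    (fun q : W₁ × ℝ ↦ if q.2 ≤ 0 then inl (c.outC q) else inr (c'.inC q)) (univ ×ˢ Ioo (-1) 1)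
  /-- the fibres over `M` -/
  fibl : ∀ x, E x ≃ₗ[𝕜] F (inl x)
  /-- the fibres over `M'` -/
  fibr : ∀ x, E' x ≃ₗ[𝕜] F (inr x)
  fib_match : ∀ (w : W₁) (v : V),
    (⟨inl (c.outC (w, 0)), fibl _ (c.triv.symm (c.outC (w, 0)) v)⟩ : TotalSpace V F) =
      ⟨inr (c'.inC (w, 0)), fibr _ (c'.triv.symm (c'.inC (w, 0)) v)⟩
  fibl_diffeo : IsOpenDiffeoOn (J.prod 𝓘(ℝ, V)) (JN.prod 𝓘(ℝ, V))
    (fun p : TotalSpace V E ↦ (⟨inl p.1, fibl p.1 p.2⟩ : TotalSpace V F)) (π V E ⁻¹' c.outBdryᶜ)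
  fibr_diffeo : IsOpenDiffeoOn (J'.prod 𝓘(ℝ, V)) (JN.prod 𝓘(ℝ, V))
    (fun p : TotalSpace V E' ↦ (⟨inr p.1, fibr p.1 p.2⟩ : TotalSpace V F))
    (π V E' ⁻¹' c'.inBdryᶜ)
  neck_triv_diffeo : IsOpenDiffeoOn ((IW.prod 𝓘(ℝ, ℝ)).prod 𝓘(ℝ, V)) (JN.prod 𝓘(ℝ, V))
    (fun p : (W₁ × ℝ) × V ↦
      if p.1.2 ≤ 0 then
        (⟨inl (c.outC p.1), fibl _ (c.triv.symm (c.outC p.1) p.2)⟩ : TotalSpace V F)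
      else ⟨inr (c'.inC p.1), fibr _ (c'.triv.symm (c'.inC p.1) p.2)⟩)
    ((univ ×ˢ Ioo (-1) 1) ×ˢ univ)

end Cobordism

end BundleGlue

end

set_option linter.unusedSectionVars false

noncomputable section

/-! Over the collar C the operator `d + f A_∇` is the affine combination (1 - f) d + f ∇ of two
connections, so it keeps the Leibniz rule. Since f = 1 near the complement of C, it continues by ∇
to a connection ∇_f on all of E (`Connection.exists_scaled`). Near the outgoing boundary f = 0, so
∇_f = d there; likewise ∇'_f' = d near the incoming boundary of M'.

The glued bundle is covered by three open pieces: M without its outgoing boundary, M' without its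
incoming boundary, and the bicollar with its trivial bundle. Transport ∇_f and ∇'_f' to the first
two and put d along W₁. Because d is natural for bundle maps compatible with the trivializations
(`IsBundleInclusion.trivialD_pull`), all three descriptions agree near W₁ and define one connection
(`exists_glued_connection`).

Connections act here on global sections, so sections of the glued bundle are pulled back to E and
E'. `IsBundleInclusion` records what this needs: an open embedding away from W₁, compatibility with
the trivializations over the bicollar, and control of neighbourhoods at W₁.
`isBundleInclusion_of_collar` supplies it for both halves. Finally, locality
(`Connection.congr_of_eventuallyEq`) replaces the pullback of σ by any section s that agrees with it
near x. -/

namespace BundleGlue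

/-! ### Smoothness of sections of Hom(TM, E) -/

section HomSection

variable {EM : Type*} [NormedAddCommGroup EM] [NormedSpace ℝ EM]
  {HM : Type*} [TopologicalSpace HM] {J : ModelWithCorners ℝ EM HM}
  {M : Type*} [TopologicalSpace M] [ChartedSpace HM M]

/-- In a basis `b` of the finite-dimensional `G`, the map `f x` is the sum of the `c i ⊗ f x (b i)`,
and each summand is a fixed continuous linear function of `f x (b i)`. -/
theorem contMDiffAt_clm_of_apply
    {G : Type*} [NormedAddCommGroup G] [NormedSpace ℝ G] [FiniteDimensional ℝ G]
    {V : Type*} [NormedAddCommGroup V] [NormedSpace ℝ V]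
    {f : M → G →L[ℝ] V} {x₀ : M} (h : ∀ v, ContMDiffAt J 𝓘(ℝ, V) ∞ (fun x ↦ f x v) x₀) :
    ContMDiffAt J 𝓘(ℝ, G →L[ℝ] V) ∞ f x₀ := by
  let b := Module.finBasis ℝ G
  let c : Fin (Module.finrank ℝ G) → G →L[ℝ] ℝ := fun i ↦ (b.coord i).toContinuousLinearMap
  have hf : f = fun x ↦ ∑ i, ContinuousLinearMap.smulRightL ℝ G V (c i) (f x (b i)) := by
    funext x
    ext v
    conv_lhs => rw [← b.sum_repr v, map_sum]
    simp [-Module.Basis.sum_repr, c]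
  rw [hf]
  exact contMDiffAt_finsetSum fun i _ ↦
    (ContinuousLinearMap.contMDiff _).contMDiffAt.comp x₀ (h (b i))

variable [IsManifold J ∞ M]
  {V : Type*} [NormedAddCommGroup V] [NormedSpace ℝ V]
  {E : M → Type*} [TopologicalSpace (TotalSpace V E)] [∀ x, TopologicalSpace (E x)]
  [∀ x, AddCommGroup (E x)] [∀ x, Module ℝ (E x)] [FiberBundle V E]
  [VectorBundle ℝ V E] [∀ x, IsTopologicalAddGroup (E x)] [∀ x, ContinuousSMul ℝ (E x)]

/-- A section of `Hom(TM, E)` is smooth if it takes smooth vector fields to smooth sections. -/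
theorem contMDiffAt_homSection [FiniteDimensional ℝ EM]
    {τ : ∀ y : M, TangentSpace J y →L[ℝ] E y} {x₀ : M}
    (h : ∀ X : ∀ y : M, TangentSpace J y,
      ContMDiffAt J (J.prod 𝓘(ℝ, EM)) ∞ (fun y ↦ (⟨y, X y⟩ : TangentBundle J M)) x₀ →
      ContMDiffAt J (J.prod 𝓘(ℝ, V)) ∞ (fun y ↦ (⟨y, τ y (X y)⟩ : TotalSpace V E)) x₀) :
    ContMDiffAt J (J.prod 𝓘(ℝ, EM →L[ℝ] V)) ∞
      (fun y ↦ TotalSpace.mk' (EM →L[ℝ] V) (E := fun y : M ↦ TangentSpace J y →L[ℝ] E y)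
        y (τ y)) x₀ := by
  rw [contMDiffAt_hom_bundle]
  refine ⟨contMDiffAt_id, contMDiffAt_clm_of_apply fun v ↦ ?_⟩
  let eT := trivializationAt EM (TangentSpace J) x₀
  have hx : x₀ ∈ eT.baseSet := mem_baseSet_trivializationAt _ _ _
  -- The test field is constant in the tangent trivialization, so applying τ to it reads off the
  -- coordinates of τ.
  have hX : ContMDiffAt J (J.prod 𝓘(ℝ, EM)) ∞
      (fun y ↦ (⟨y, eT.symm y v⟩ : TangentBundle J M)) x₀ := by
    rw [eT.contMDiffAt_section_iff hx]
    refine (contMDiffAt_const (c := v)).congr_of_eventuallyEq ?_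
    filter_upwards [eT.open_baseSet.mem_nhds hx] with y hy
    rw [eT.apply_mk_symm hy]
  have := (contMDiffAt_section x₀).1 (h _ hX)
  refine this.congr_of_eventuallyEq ?_
  filter_upwards [eT.open_baseSet.mem_nhds hx, (trivializationAt V E x₀).open_baseSet.mem_nhds
    (mem_baseSet_trivializationAt V E x₀)] with y hy hy'
  rw [ContinuousLinearMap.inCoordinates_eq hy hy']
  simp [eT]

end HomSection

/-! ### Derivatives along smooth vector fields -/

section TangentMap

variable {EM : Type*} [NormedAddCommGroup EM] [NormedSpace ℝ EM]
  {HM : Type*} [TopologicalSpace HM] {J : ModelWithCorners ℝ EM HM}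
  {M : Type*} [TopologicalSpace M] [ChartedSpace HM M] [IsManifold J ∞ M]
  {EN : Type*} [NormedAddCommGroup EN] [NormedSpace ℝ EN]
  {HN : Type*} [TopologicalSpace HN] {JN : ModelWithCorners ℝ EN HN}
  {N : Type*} [TopologicalSpace N] [ChartedSpace HN N] [IsManifold JN ∞ N]

/-- The derivative costs one order of smoothness, which is harmless at order ∞. -/
theorem contMDiffAt_mfderiv_apply {φ : M → N} {x₀ : M} (hφ : ContMDiffAt J JN ∞ φ x₀)
    {X : ∀ y : M, TangentSpace J y}
    (hX : ContMDiffAt J (J.prod 𝓘(ℝ, EM)) ∞ (fun y ↦ (⟨y, X y⟩ : TangentBundle J M)) x₀) :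
    ContMDiffAt J (JN.prod 𝓘(ℝ, EN)) ∞
      (fun y ↦ (⟨φ y, mfderiv J JN φ y (X y)⟩ : TangentBundle JN N)) x₀ :=
  ContMDiffAt.clm_apply_of_inCoordinates (hφ.mfderiv_const (m := ∞) le_rfl) hX hφ

theorem contMDiffAt_mvfderiv_apply {V : Type*} [NormedAddCommGroup V] [NormedSpace ℝ V]
    {u : M → V} {x₀ : M} (hu : ContMDiffAt J 𝓘(ℝ, V) ∞ u x₀)
    {X : ∀ y : M, TangentSpace J y}
    (hX : ContMDiffAt J (J.prod 𝓘(ℝ, EM)) ∞ (fun y ↦ (⟨y, X y⟩ : TangentBundle J M)) x₀) :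
    ContMDiffAt J 𝓘(ℝ, V) ∞ (fun y ↦ mvfderiv J u y (X y)) x₀ :=
  ((contMDiff_snd_tangentBundle_modelSpace V 𝓘(ℝ, V)).contMDiffAt).comp x₀
    (contMDiffAt_mfderiv_apply hu hX)

-- Scalar multiplication 𝕜 × V → V is real bilinear, so the real derivative obeys the product rule
-- for 𝕜-valued r. The identity `w = r u` is only local because a trivialization is linear only over
-- its base set.
omit [IsManifold J ∞ M] in
theorem mvfderiv_smul_apply {𝕜 : Type*} [RCLike 𝕜] {V : Type*} [NormedAddCommGroup V]
    [NormedSpace ℝ V] [NormedSpace 𝕜 V] [IsScalarTower ℝ 𝕜 V] {r : M → 𝕜} {u w : M → V} {x : M}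
    (hr : MDifferentiableAt J 𝓘(ℝ, 𝕜) r x) (hu : MDifferentiableAt J 𝓘(ℝ, V) u x)
    (hw : ∀ᶠ y in 𝓝 x, w y = r y • u y) (v : TangentSpace J x) :
    mvfderiv J w x v = r x • mvfderiv J u x v + mvfderiv J r x v • u x := by
  have h1 := hr.hasMFDerivAt
  have h2 := hu.hasMFDerivAt
  have h3 : HasMFDerivAt J 𝓘(ℝ, V) (fun y ↦ r y • u y) x
      (r x • (mvfderiv J u x : EM →L[ℝ] V) +
        (mvfderiv J r x : EM →L[ℝ] 𝕜).smulRight (u x) : EM →L[ℝ] V) := by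
    refine ⟨h1.1.smul h2.1, ?_⟩
    convert! h1.2.smul h2.2 using 1
    simp
    rfl
  have h4 : mfderiv J 𝓘(ℝ, V) w x = _ := (h3.congr_of_eventuallyEq hw).mfderiv
  exact congrArg (fun L : EM →L[ℝ] V ↦ L v) h4

end TangentMap

/-! ### Smooth local trivializations -/

section SmoothTriv

variable {EM : Type*} [NormedAddCommGroup EM] [NormedSpace ℝ EM]
  {HM : Type*} [TopologicalSpace HM] (J : ModelWithCorners ℝ EM HM)
  {M : Type*} [TopologicalSpace M] [ChartedSpace HM M]
  (𝕜 : Type*) [RCLike 𝕜]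
  {V : Type*} [NormedAddCommGroup V] [NormedSpace ℝ V] [NormedSpace 𝕜 V]
  {E : M → Type*} [TopologicalSpace (TotalSpace V E)] [∀ x, TopologicalSpace (E x)]
  [∀ x, AddCommGroup (E x)] [∀ x, Module 𝕜 (E x)] [FiberBundle V E]

/-- A smooth `𝕜`-linear local trivialization. -/
structure IsSmoothTriv (e : Trivialization V (π V E)) : Prop where
  linear : e.IsLinear 𝕜
  smooth : ContMDiffOn (J.prod 𝓘(ℝ, V)) (J.prod 𝓘(ℝ, V)) ∞ e e.source
  symm_smooth : ContMDiffOn (J.prod 𝓘(ℝ, V)) (J.prod 𝓘(ℝ, V)) ∞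
    e.toOpenPartialHomeomorph.symm e.target

variable {J 𝕜}
variable {EN : Type*} [NormedAddCommGroup EN] [NormedSpace ℝ EN]
  {HN : Type*} [TopologicalSpace HN] {JN : ModelWithCorners ℝ EN HN}
  {N : Type*} [TopologicalSpace N] [ChartedSpace HN N]

theorem IsSmoothTriv.contMDiffAt_snd {e : Trivialization V (π V E)} (he : IsSmoothTriv J 𝕜 e)
    {f : N → TotalSpace V E} {y : N} (hf : ContMDiffAt JN (J.prod 𝓘(ℝ, V)) ∞ f y)
    (hy : (f y).1 ∈ e.baseSet) : ContMDiffAt JN 𝓘(ℝ, V) ∞ (fun z ↦ (e (f z)).2) y := by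
  have h := (he.smooth.contMDiffAt (e.open_source.mem_nhds (e.mem_source.2 hy))).comp y hf
  exact ContMDiffAt.comp y _root_.contMDiffAt_snd h

theorem IsSmoothTriv.contMDiffAt_mk_symm {e : Trivialization V (π V E)} (he : IsSmoothTriv J 𝕜 e)
    {b : N → M} {w : N → V} {y : N} (hb : ContMDiffAt JN J ∞ b y)
    (hw : ContMDiffAt JN 𝓘(ℝ, V) ∞ w y) (hy : b y ∈ e.baseSet) :
    ContMDiffAt JN (J.prod 𝓘(ℝ, V)) ∞ (fun z ↦ (⟨b z, e.symm (b z) (w z)⟩ : TotalSpace V E)) y := by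
  have h := (he.symm_smooth.contMDiffAt (e.open_target.mem_nhds
    (e.mem_target.2 (show (b y, w y).1 ∈ e.baseSet from hy)))).comp y (hb.prodMk hw)
  refine h.congr_of_eventuallyEq ?_
  filter_upwards [hb.continuousAt (e.open_baseSet.mem_nhds hy)] with z hz
  exact e.mk_symm hz (w z)

theorem IsSmoothTriv.symm_add {e : Trivialization V (π V E)} (he : IsSmoothTriv J 𝕜 e) {x : M}
    (hx : x ∈ e.baseSet) (v w : V) : e.symm x (v + w) = e.symm x v + e.symm x w :=
  have := he.linear
  (e.linearEquivAt 𝕜 x hx).symm.map_add v w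

theorem IsSmoothTriv.symm_smul {e : Trivialization V (π V E)} (he : IsSmoothTriv J 𝕜 e) {x : M}
    (hx : x ∈ e.baseSet) (c : 𝕜) (v : V) : e.symm x (c • v) = c • e.symm x v :=
  have := he.linear
  (e.linearEquivAt 𝕜 x hx).symm.map_smul c v

theorem IsSmoothTriv.mdifferentiableAt_sec {e : Trivialization V (π V E)}
    (he : IsSmoothTriv J 𝕜 e) (s : Sec J V E) {x : M} (hx : x ∈ e.baseSet) :
    MDifferentiableAt J 𝓘(ℝ, V) (fun y ↦ (e ⟨y, s y⟩).2) x :=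
  (he.contMDiffAt_snd (s.contMDiff x) hx).mdifferentiableAt (by simp)

end SmoothTriv

/-! ### The exterior derivative in a trivialization -/

section TrivialD

variable {EM : Type*} [NormedAddCommGroup EM] [NormedSpace ℝ EM]
  {HM : Type*} [TopologicalSpace HM] {J : ModelWithCorners ℝ EM HM}
  {M : Type*} [TopologicalSpace M] [ChartedSpace HM M]
  {𝕜 : Type*} [RCLike 𝕜]
  {V : Type*} [NormedAddCommGroup V] [NormedSpace ℝ V] [NormedSpace 𝕜 V] [IsScalarTower ℝ 𝕜 V]
  {E : M → Type*} [TopologicalSpace (TotalSpace V E)] [∀ x, TopologicalSpace (E x)]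
  [∀ x, AddCommGroup (E x)] [∀ x, Module ℝ (E x)] [∀ x, Module 𝕜 (E x)]
  [∀ x, IsScalarTower ℝ 𝕜 (E x)]
  [FiberBundle V E]

theorem IsSmoothTriv.isLinear_real {e : Trivialization V (π V E)} (he : IsSmoothTriv J 𝕜 e) :
    e.IsLinear ℝ := by
  have := he.linear
  refine ⟨fun b hb ↦ ?_⟩
  exact ((e.linearEquivAt 𝕜 b hb).toLinearMap.restrictScalars ℝ).isLinear

variable {e : Trivialization V (π V E)}

omit [∀ x, Module 𝕜 (E x)] [∀ x, IsScalarTower ℝ 𝕜 (E x)] [IsScalarTower ℝ 𝕜 V] in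
theorem trivialD_eq (s : Sec J V E) (x : M) (v : TangentSpace J x) :
    trivialD e s x v = e.symm x (mvfderiv J (fun y ↦ (e ⟨y, s y⟩).2) x v) :=
  rfl

variable (he : IsSmoothTriv J 𝕜 e)
include he

theorem IsSmoothTriv.trivialD_leibniz {r : M → 𝕜} (hr : ContMDiff J 𝓘(ℝ, 𝕜) ∞ r) {s t : Sec J V E}
    (h : ∀ x, t x = r x • s x) {x : M} (hx : x ∈ e.baseSet) (v : TangentSpace J x) :
    trivialD e t x v = r x • trivialD e s x v + mvfderiv J r x v • s x := by
  have := he.linear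
  have key := mvfderiv_smul_apply (w := fun y ↦ (e ⟨y, t y⟩).2) (hr.mdifferentiableAt (by simp))
    (he.mdifferentiableAt_sec s hx) (by
      filter_upwards [e.open_baseSet.mem_nhds hx] with y hy
      rw [h y]
      exact (e.linearEquivAt 𝕜 y hy).map_smul (r y) (s y)) v
  rw [trivialD_eq, trivialD_eq, key, he.symm_add hx, he.symm_smul hx, he.symm_smul hx,
    e.symm_apply_apply_mk hx]

/-- Linearity suffices for later use: continuity in v will follow from the finite dimension of the
tangent space. -/
theorem IsSmoothTriv.trivialD_linear (s : Sec J V E) {x : M} (hx : x ∈ e.baseSet) :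
    ∃ L : TangentSpace J x →ₗ[ℝ] E x, ∀ v, L v = trivialD e s x v := by
  have := he.isLinear_real
  exact ⟨(e.linearEquivAt ℝ x hx).symm.toLinearMap ∘ₗ
    (mvfderiv J (fun y ↦ (e ⟨y, s y⟩).2) x).toLinearMap, fun v ↦ rfl⟩

theorem IsSmoothTriv.contMDiffAt_trivialD [IsManifold J ∞ M]
    (s : Sec J V E) {x : M} (hx : x ∈ e.baseSet) {X : ∀ y : M, TangentSpace J y}
    (hX : ContMDiffAt J (J.prod 𝓘(ℝ, EM)) ∞ (fun y ↦ (⟨y, X y⟩ : TangentBundle J M)) x) :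
    ContMDiffAt J (J.prod 𝓘(ℝ, V)) ∞
      (fun y ↦ (⟨y, trivialD e s y (X y)⟩ : TotalSpace V E)) x :=
  he.contMDiffAt_mk_symm contMDiffAt_id (contMDiffAt_mvfderiv_apply
    (he.contMDiffAt_snd (s.contMDiff x) hx) hX) hx

theorem IsSmoothTriv.trivialD_add [VectorBundle ℝ V E] (s t : Sec J V E) {x : M}
    (hx : x ∈ e.baseSet) (v : TangentSpace J x) :
    trivialD e (s + t) x v = trivialD e s x v + trivialD e t x v := by
  have := he.linear
  have h : HasMFDerivAt J 𝓘(ℝ, V) (fun y ↦ (e ⟨y, (s + t) y⟩).2) x _ :=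
    ((he.mdifferentiableAt_sec s hx).hasMFDerivAt.add
      (he.mdifferentiableAt_sec t hx).hasMFDerivAt).congr_of_eventuallyEq (by
        filter_upwards [e.open_baseSet.mem_nhds hx] with y hy
        exact (e.linearEquivAt 𝕜 y hy).map_add (s y) (t y))
  have h' : mvfderiv J (fun y ↦ (e ⟨y, (s + t) y⟩).2) x v =
      mvfderiv J (fun y ↦ (e ⟨y, s y⟩).2) x v + mvfderiv J (fun y ↦ (e ⟨y, t y⟩).2) x v :=
    congrArg (fun L : EM →L[ℝ] V ↦ L v) h.mfderiv
  rw [trivialD_eq, trivialD_eq, trivialD_eq, h', he.symm_add hx]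

end TrivialD

/-! ### Connections: locality and scaling of the connection form -/

section ConnectionTheory

variable {EM : Type*} [NormedAddCommGroup EM] [NormedSpace ℝ EM]
  {HM : Type*} [TopologicalSpace HM] {J : ModelWithCorners ℝ EM HM}
  {M : Type*} [TopologicalSpace M] [ChartedSpace HM M] [IsManifold J ∞ M]
  {𝕜 : Type*} [RCLike 𝕜]
  {V : Type*} [NormedAddCommGroup V] [NormedSpace ℝ V]
  {E : M → Type*} [TopologicalSpace (TotalSpace V E)] [∀ x, TopologicalSpace (E x)]
  [∀ x, AddCommGroup (E x)] [∀ x, Module ℝ (E x)] [∀ x, Module 𝕜 (E x)]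
  [FiberBundle V E] [VectorBundle ℝ V E]
  [∀ x, IsTopologicalAddGroup (E x)] [∀ x, ContinuousSMul ℝ (E x)]

/-- A connection from an additive operator on sections that satisfies the Leibniz rule. -/
def Connection.ofLeibniz (op : Sec J V E → ∀ x : M, TangentSpace J x →L[ℝ] E x)
    (smooth : ∀ s, ContMDiff J (J.prod 𝓘(ℝ, EM →L[ℝ] V)) ∞
      (fun x ↦ TotalSpace.mk' (EM →L[ℝ] V) (E := fun y : M ↦ TangentSpace J y →L[ℝ] E y)
        x (op s x)))
    (add : ∀ s t x v, op (s + t) x v = op s x v + op t x v)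
    (leibniz : ∀ r : M → 𝕜, ContMDiff J 𝓘(ℝ, 𝕜) ∞ r → ∀ s t : Sec J V E, (∀ x, t x = r x • s x) →
      ∀ x v, op t x v = r x • op s x v + mvfderiv J r x v • s x) : Connection J V E 𝕜 where
  toFun s := ⟨op s, smooth s⟩
  map_add s t := by
    ext x : 1
    exact ContinuousLinearMap.ext (add s t x)
  map_smul c s t h x v := by
    have := leibniz (fun _ ↦ c) contMDiff_const s t h x v
    -- Homogeneity is the Leibniz rule for a constant r, whose derivative vanishes.
    rwa [mvfderiv_const, zero_apply, zero_smul, add_zero] at this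
  leibniz r hr s t h x v := leibniz r hr s t h x v

theorem Connection.leibniz_mvfderiv (D : Connection J V E 𝕜) {r : M → 𝕜}
    (hr : ContMDiff J 𝓘(ℝ, 𝕜) ∞ r) {s t : Sec J V E} (h : ∀ x, t x = r x • s x) (x : M)
    (v : TangentSpace J x) : D.toFun t x v = r x • D.toFun s x v + mvfderiv J r x v • s x :=
  D.leibniz r hr s t h x v

theorem Connection.map_add_apply (D : Connection J V E 𝕜) (s t : Sec J V E) (x : M)
    (v : TangentSpace J x) : D.toFun (s + t) x v = D.toFun s x v + D.toFun t x v := by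
  rw [D.map_add]
  rfl

/-- Connections are local operators. -/
theorem Connection.congr_of_eventuallyEq [FiniteDimensional ℝ EM] [T2Space M]
    (D : Connection J V E 𝕜) {s t : Sec J V E} {x : M} (h : ∀ᶠ y in 𝓝 x, s y = t y)
    (v : TangentSpace J x) : D.toFun s x v = D.toFun t x v := by
  obtain ⟨f, -, hf⟩ := (SmoothBumpFunction.nhds_basis_support (I := J) h).mem_iff.1 h
  -- The bump function f is supported where s = t, so s - t = (1 - f)(s - t). Both Leibniz terms
  -- vanish at x, as r and s - t do.
  let r : M → 𝕜 := fun y ↦ ((1 - f y : ℝ) : 𝕜)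
  have hr : ContMDiff J 𝓘(ℝ, 𝕜) ∞ r :=
    (RCLike.ofRealCLM (K := 𝕜)).contMDiff.comp (contMDiff_const.sub f.contMDiff)
  have hu : ∀ y, (s - t) y = r y • (s - t) y := by
    intro y
    by_cases hy : y ∈ Function.support f
    · have : (s - t) y = 0 := sub_eq_zero.2 (hf hy)
      rw [this, smul_zero]
    · simp [r, Function.notMem_support.1 hy]
  have h0 : (s - t) x = 0 := sub_eq_zero.2 h.self_of_nhds
  have hrx : r x = 0 := by simp [r]
  have key := D.leibniz_mvfderiv hr hu x v
  rw [hrx, h0, smul_zero, zero_smul, add_zero] at key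
  have := D.map_add_apply (s - t) t x v
  rwa [sub_add_cancel, key, zero_add] at this

variable [FiniteDimensional ℝ EM] [NormedSpace 𝕜 V] [IsScalarTower ℝ 𝕜 V]
  [∀ x, IsScalarTower ℝ 𝕜 (E x)] [ContMDiffVectorBundle ∞ V E J]

/-- If `f = 1` near the complement of the base set of `e`, then the operators `d + f A_∇` over the
base set of `e` and `∇` elsewhere fit together to a connection. -/
theorem Connection.exists_scaled (D : Connection J V E 𝕜) {e : Trivialization V (π V E)}
    (he : IsSmoothTriv J 𝕜 e) {f : M → ℝ} (hf : ContMDiff J 𝓘(ℝ, ℝ) ∞ f)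
    (hf1 : ∀ x ∉ e.baseSet, ∀ᶠ y in 𝓝 x, f y = 1) :
    ∃ D' : Connection J V E 𝕜, (∀ s, ∀ x ∈ e.baseSet, ∀ v, D'.toFun s x v = D.scaled e f s x v) ∧
      ∀ s, ∀ x ∉ e.baseSet, ∀ v, D'.toFun s x v = D.toFun s x v := by
  have hex : ∀ (s : Sec J V E) (x : M), ∃ L : TangentSpace J x →L[ℝ] E x,
      (x ∈ e.baseSet → ∀ v, L v = D.scaled e f s x v) ∧
      (x ∉ e.baseSet → ∀ v, L v = D.toFun s x v) := by
    intro s x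
    by_cases hx : x ∈ e.baseSet
    · obtain ⟨L, hL⟩ := he.trivialD_linear s hx
      have : FiniteDimensional ℝ (TangentSpace J x) := inferInstanceAs (FiniteDimensional ℝ EM)
      have : T2Space (TangentSpace J x) := inferInstanceAs (T2Space EM)
      refine ⟨LinearMap.toContinuousLinearMap (L + f x • ((D.toFun s x).toLinearMap - L)),
        fun _ v ↦ ?_, fun h ↦ absurd hx h⟩
      simp [Connection.scaled, Connection.form, hL]
    · exact ⟨D.toFun s x, fun h ↦ absurd h hx, fun _ v ↦ rfl⟩
  choose op hop1 hop2 using hex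
  -- The two recipes coincide where f = 1, hence on a neighbourhood of every point outside the base
  -- set; this gives smoothness there.
  have hopD : ∀ s x, f x = 1 → op s x = D.toFun s x := by
    intro s x h1
    ext v
    by_cases hx : x ∈ e.baseSet
    · rw [hop1 s x hx, Connection.scaled, Connection.form, h1, one_smul, add_sub_cancel]
    · exact hop2 s x hx v
  refine ⟨Connection.ofLeibniz op ?_ ?_ ?_, hop1, hop2⟩
  · intro s x
    by_cases hx : x ∈ e.baseSet
    · refine contMDiffAt_homSection fun X hX ↦ ?_
      have h1 := he.contMDiffAt_trivialD s hx hX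
      have h2 := (D.toFun s).contMDiff.contMDiffAt.clm_bundle_apply hX
      refine (h1.add_section ((hf x).smul_section (h2.sub_section h1))).congr_of_eventuallyEq ?_
      filter_upwards [e.open_baseSet.mem_nhds hx] with y hy
      rw [hop1 s y hy]
      rfl
    · refine ((D.toFun s).contMDiff x).congr_of_eventuallyEq ?_
      filter_upwards [hf1 x hx] with y hy
      rw [hopD s y hy]
  · intro s t x v
    by_cases hx : x ∈ e.baseSet
    · simp only [hop1 _ x hx, Connection.scaled, Connection.form, D.map_add_apply,
        he.trivialD_add s t hx]
      module
    · simp only [hop2 _ x hx, D.map_add_apply]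
  · intro r hr s t h x v
    by_cases hx : x ∈ e.baseSet
    · simp only [hop1 _ x hx, Connection.scaled, Connection.form, D.leibniz_mvfderiv hr h,
        he.trivialD_leibniz hr h hx]
      -- The terms dr ⊗ s of ∇ and of d cancel in A_∇, which is therefore tensorial; the one from d
      -- remains.
      rw [add_sub_add_right_eq_sub, ← smul_sub, smul_comm (f x) (r x), smul_add]
      abel
    · simp only [hop2 _ x hx, D.leibniz_mvfderiv hr h]

end ConnectionTheory

/-! ### Diffeomorphisms onto open subsets -/

section OpenDiffeo

variable {E₁ : Type*} [NormedAddCommGroup E₁] [NormedSpace ℝ E₁] {H₁ : Type*} [TopologicalSpace H₁]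
  {I₁ : ModelWithCorners ℝ E₁ H₁} {X : Type*} [TopologicalSpace X] [ChartedSpace H₁ X]
  {E₂ : Type*} [NormedAddCommGroup E₂] [NormedSpace ℝ E₂] {H₂ : Type*} [TopologicalSpace H₂]
  {I₂ : ModelWithCorners ℝ E₂ H₂} {Y : Type*} [TopologicalSpace Y] [ChartedSpace H₂ Y]

theorem IsOpenDiffeoOn.exists_inverse {g : X → Y} {s : Set X} (hg : IsOpenDiffeoOn I₁ I₂ g s)
    {x : X} (hx : x ∈ s) : ∃ h : Y → X, ContMDiffOn I₂ I₁ ∞ h (g '' s) ∧ LeftInvOn h g s :=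
  hg.2.2 ⟨x, hx⟩

theorem IsOpenDiffeoOn.image_mem_nhds {g : X → Y} {s : Set X} (hg : IsOpenDiffeoOn I₁ I₂ g s)
    {x : X} (hx : x ∈ s) : g '' s ∈ 𝓝 (g x) :=
  hg.2.1.mem_nhds (mem_image_of_mem g hx)

theorem IsOpenDiffeoOn.injOn {g : X → Y} {s : Set X} (hg : IsOpenDiffeoOn I₁ I₂ g s) :
    InjOn g s := by
  intro x hx y hy hxy
  obtain ⟨h, -, hh⟩ := hg.exists_inverse hx
  rw [← hh hx, hxy, hh hy]

end OpenDiffeo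

/-! ### Existence of bump functions -/

section Bump

variable {EW : Type*} [NormedAddCommGroup EW] [NormedSpace ℝ EW]
  {HW : Type*} [TopologicalSpace HW] {IW : ModelWithCorners ℝ EW HW}
  {W₀ : Type*} [TopologicalSpace W₀] [ChartedSpace HW W₀]
  {W₁ : Type*} [TopologicalSpace W₁] [ChartedSpace HW W₁]
  {EM : Type*} [NormedAddCommGroup EM] [NormedSpace ℝ EM]
  {HM : Type*} [TopologicalSpace HM] {J : ModelWithCorners ℝ EM HM}
  {M : Type*} [TopologicalSpace M] [ChartedSpace HM M]
  {𝕜 : Type*} [RCLike 𝕜]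
  {V : Type*} [NormedAddCommGroup V] [NormedSpace ℝ V] [NormedSpace 𝕜 V]
  {E : M → Type*} [TopologicalSpace (TotalSpace V E)] [∀ x, TopologicalSpace (E x)]
  [∀ x, AddCommGroup (E x)] [∀ x, Module 𝕜 (E x)]
  [FiberBundle V E]

theorem isClosed_range_slice [CompactSpace W₁] [T2Space M] {k : W₁ × ℝ → M} {S : Set ℝ}
    (hk : IsOpenDiffeoOn (IW.prod 𝓘(ℝ, ℝ)) J k (univ ×ˢ S)) (h0 : (0 : ℝ) ∈ S) :
    IsClosed (range fun w ↦ k (w, 0)) :=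
  (isCompact_range (hk.1.continuousOn.comp_continuous (by fun_prop)
    fun _ ↦ mk_mem_prod (mem_univ _) h0)).isClosed

theorem BundleCobordism.isClosed_inBdry [CompactSpace W₀] [T2Space M]
    (c : BundleCobordism IW W₀ W₁ J 𝕜 V E) : IsClosed c.inBdry :=
  isClosed_range_slice c.inC_diffeo (by simp)

theorem BundleCobordism.isClosed_outBdry [CompactSpace W₁] [T2Space M]
    (c : BundleCobordism IW W₀ W₁ J 𝕜 V E) : IsClosed c.outBdry :=
  isClosed_range_slice c.outC_diffeo (by simp)

theorem BundleCobordism.inBdry_subset (c : BundleCobordism IW W₀ W₁ J 𝕜 V E) :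
    c.inBdry ⊆ c.collar := by
  rintro _ ⟨w, rfl⟩
  exact Or.inl (mem_image_of_mem _ (by simp))

theorem BundleCobordism.outBdry_subset (c : BundleCobordism IW W₀ W₁ J 𝕜 V E) :
    c.outBdry ⊆ c.collar := by
  rintro _ ⟨w, rfl⟩
  exact Or.inr (mem_image_of_mem _ (by simp))

theorem BundleCobordism.isSmoothTriv (c : BundleCobordism IW W₀ W₁ J 𝕜 V E) :
    IsSmoothTriv J 𝕜 c.triv :=
  ⟨c.triv_linear, c.triv_smooth, c.triv_symm_smooth⟩

/-- Smooth Urysohn lemma: the boundary slices are closed as compact images of W₀ and W₁, and they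
lie in the open collar, so they are disjoint from its closed complement. -/
theorem BundleCobordism.exists_isBump [CompactSpace W₀] [CompactSpace W₁] [T2Space M]
    [CompactSpace M] [FiniteDimensional ℝ EM] [IsManifold J ∞ M]
    (c : BundleCobordism IW W₀ W₁ J 𝕜 V E) : ∃ f, c.IsBump f := by
  have ho : IsOpen c.collar := c.inC_diffeo.2.1.union c.outC_diffeo.2.1
  obtain ⟨f, hf0, hf1, hf⟩ := exists_contMDiffMap_zero_one_nhds_of_isClosed J (n := ⊤)
    (c.isClosed_inBdry.union c.isClosed_outBdry) ho.isClosed_compl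
    (disjoint_compl_right_iff_subset.2 (union_subset c.inBdry_subset c.outBdry_subset))
  exact ⟨f, f.contMDiff, hf, fun x hx ↦ eventually_nhdsSet_iff_forall.1 hf0 x hx,
    fun x hx ↦ eventually_nhdsSet_iff_forall.1 hf1 x hx⟩

end Bump

/-! ### Bundle inclusions and pullback of sections -/

section Inclusion

variable {EM : Type*} [NormedAddCommGroup EM] [NormedSpace ℝ EM]
  {HM : Type*} [TopologicalSpace HM] (J : ModelWithCorners ℝ EM HM)
  {M : Type*} [TopologicalSpace M] [ChartedSpace HM M]
  {𝕜 : Type*} [RCLike 𝕜]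
  {V : Type*} [NormedAddCommGroup V] [NormedSpace ℝ V] [NormedSpace 𝕜 V] [IsScalarTower ℝ 𝕜 V]
  {E : M → Type*} [TopologicalSpace (TotalSpace V E)] [∀ x, TopologicalSpace (E x)]
  [∀ x, AddCommGroup (E x)] [∀ x, Module ℝ (E x)] [∀ x, Module 𝕜 (E x)]
  [∀ x, IsScalarTower ℝ 𝕜 (E x)] [FiberBundle V E]
  {EN : Type*} [NormedAddCommGroup EN] [NormedSpace ℝ EN]
  {HN : Type*} [TopologicalSpace HN] (JN : ModelWithCorners ℝ EN HN)
  {N : Type*} [TopologicalSpace N] [ChartedSpace HN N]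
  {F : N → Type*} [TopologicalSpace (TotalSpace V F)] [∀ x, TopologicalSpace (F x)]
  [∀ x, AddCommGroup (F x)] [∀ x, Module ℝ (F x)] [∀ x, Module 𝕜 (F x)]
  [∀ x, IsScalarTower ℝ 𝕜 (F x)] [FiberBundle V F]

/-- A smooth injective map of bundles `E → F` over `φ : M → N`, which is an open embedding away
from the closed set `B`, and which near `B` is compatible with given smooth trivializations
`e` of `E` and `ε` of `F`. -/
structure IsBundleInclusion (φ : M → N) (fib : ∀ x, E x ≃ₗ[𝕜] F (φ x)) (B : Set M)
    (e : Trivialization V (π V E)) (ε : Trivialization V (π V F)) : Prop where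
  injective : φ.Injective
  smooth : ContMDiff J JN ∞ φ
  isClosed : IsClosed B
  diffeo : IsOpenDiffeoOn J JN φ Bᶜ
  fib_diffeo : IsOpenDiffeoOn (J.prod 𝓘(ℝ, V)) (JN.prod 𝓘(ℝ, V))
    (fun p : TotalSpace V E ↦ (⟨φ p.1, fib p.1 p.2⟩ : TotalSpace V F)) (π V E ⁻¹' Bᶜ)
  triv : IsSmoothTriv J 𝕜 e
  triv' : IsSmoothTriv JN 𝕜 ε
  mem_baseSet : ∀ x, φ x ∈ ε.baseSet → x ∈ e.baseSet
  bdry_mem : ∀ x ∈ B, φ x ∈ ε.baseSet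
  compat : ∀ x, φ x ∈ ε.baseSet → ∀ z : E x, (ε ⟨φ x, fib x z⟩).2 = (e ⟨x, z⟩).2
  comap_le : ∀ x ∈ B, comap φ (𝓝 (φ x)) ≤ 𝓝 x

variable {J JN}
variable {φ : M → N} {fib : ∀ x, E x ≃ₗ[𝕜] F (φ x)} {B : Set M}
    {e : Trivialization V (π V E)} {ε : Trivialization V (π V F)}
    (h : IsBundleInclusion J JN φ fib B e ε)

namespace IsBundleInclusion

-- Away from B the open embedding of total spaces is inverted. At B, where the map need not be open,
-- the pulled-back section has the same coordinate in `e` as σ has in `ε`, and no inverse is needed.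
include h in
theorem contMDiff_pull (σ : Sec JN V F) : ContMDiff J (J.prod 𝓘(ℝ, V)) ∞
    (fun x ↦ (⟨x, (fib x).symm (σ (φ x))⟩ : TotalSpace V E)) := by
  intro x
  have hσ : ContMDiff J (JN.prod 𝓘(ℝ, V)) ∞ (fun x ↦ (⟨φ x, σ (φ x)⟩ : TotalSpace V F)) :=
    σ.contMDiff.comp h.smooth
  by_cases hx : x ∈ B
  · have h1 : ContMDiffAt J 𝓘(ℝ, V) ∞ (fun y ↦ (ε ⟨φ y, σ (φ y)⟩).2) x :=
      h.triv'.contMDiffAt_snd (hσ x) (h.bdry_mem x hx)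
    refine (h.triv.contMDiffAt_mk_symm contMDiffAt_id h1
      (h.mem_baseSet x (h.bdry_mem x hx))).congr_of_eventuallyEq ?_
    filter_upwards [h.smooth.continuous.continuousAt (ε.open_baseSet.mem_nhds (h.bdry_mem x hx))]
      with y hy
    have := h.compat y hy ((fib y).symm (σ (φ y)))
    rw [LinearEquiv.apply_symm_apply] at this
    change _ = (⟨y, e.symm y _⟩ : TotalSpace V E)
    rw [this, e.symm_apply_apply_mk (h.mem_baseSet y hy)]
  · obtain ⟨k, hk, hk'⟩ := h.fib_diffeo.exists_inverse
      (x := (⟨x, (fib x).symm (σ (φ x))⟩ : TotalSpace V E)) hx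
    have hmem := h.fib_diffeo.image_mem_nhds
      (x := (⟨x, (fib x).symm (σ (φ x))⟩ : TotalSpace V E)) hx
    simp only [LinearEquiv.apply_symm_apply] at hmem
    refine ((hk.contMDiffAt hmem).comp x (hσ x)).congr_of_eventuallyEq ?_
    filter_upwards [h.isClosed.isOpen_compl.mem_nhds hx] with y hy
    have := hk' (x := (⟨y, (fib y).symm (σ (φ y))⟩ : TotalSpace V E)) hy
    simp only [LinearEquiv.apply_symm_apply] at this
    exact this.symm

/-- The pullback of a section along a bundle inclusion. -/
def pull (σ : Sec JN V F) : Sec J V E := ⟨_, h.contMDiff_pull σ⟩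

@[simp]
theorem fib_pull (σ : Sec JN V F) (x : M) : fib x (h.pull σ x) = σ (φ x) :=
  (fib x).apply_symm_apply _

theorem pull_add [VectorBundle ℝ V E] [VectorBundle ℝ V F] (σ τ : Sec JN V F) :
    h.pull (σ + τ) = h.pull σ + h.pull τ := by
  ext x
  exact (fib x).symm.map_add _ _

theorem pull_smul {σ τ : Sec JN V F} {r : N → 𝕜} (hr : ∀ y, τ y = r y • σ y) (x : M) :
    h.pull τ x = r (φ x) • h.pull σ x := by
  refine Eq.trans ?_ ((fib x).symm.map_smul _ _)
  rw [← hr]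
  rfl

include h in
theorem mdifferentiableAt (x : M) : MDifferentiableAt J JN φ x :=
  h.smooth.mdifferentiableAt (by simp)

/-- The exterior derivative is natural for bundle inclusions. -/
theorem trivialD_pull (σ : Sec JN V F) {x : M} (hx : φ x ∈ ε.baseSet) (v : TangentSpace J x) :
    trivialD ε σ (φ x) (mfderiv J JN φ x v) = fib x (trivialD e (h.pull σ) x v) := by
  have hev : (fun y ↦ (e ⟨y, h.pull σ y⟩).2) =ᶠ[𝓝 x]
      (fun z ↦ (ε ⟨z, σ z⟩).2) ∘ φ := by
    filter_upwards [h.smooth.continuous.continuousAt (ε.open_baseSet.mem_nhds hx)] with y hy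
    rw [← h.compat y hy, h.fib_pull]
    rfl
  have hd : mvfderiv J (fun y ↦ (e ⟨y, h.pull σ y⟩).2) x v =
      mvfderiv JN (fun z ↦ (ε ⟨z, σ z⟩).2) (φ x) (mfderiv J JN φ x v) := by
    have h1 := hev.mfderiv_eq (I := J) (I' := 𝓘(ℝ, V))
    rw [mfderiv_comp x (h.triv'.mdifferentiableAt_sec σ hx) (h.mdifferentiableAt x)] at h1
    exact congrArg (fun L : EM →L[ℝ] V ↦ L v) h1
  rw [trivialD_eq, trivialD_eq, ← hd]
  have h2 := h.compat x hx (e.symm x (mvfderiv J (fun y ↦ (e ⟨y, h.pull σ y⟩).2) x v))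
  rw [e.apply_mk_symm (h.mem_baseSet x hx)] at h2
  dsimp only at h2
  rw [← ε.symm_apply_apply_mk hx (fib x _), h2]

include h in
/-- Away from `B`, a bundle inclusion has a smooth local inverse. -/
theorem exists_inverse {x : M} (hx : x ∉ B) : ∃ k : N → M, ContMDiffOn JN J ∞ k (φ '' Bᶜ) ∧
    (∀ y ∉ B, k (φ y) = y) ∧
    (∀ y ∉ B, ∀ w : EN, (mfderiv J JN φ y (mfderiv JN J k (φ y) w : EM) : EN) = w) ∧
    ∀ y ∉ B, ∀ v : EM, (mfderiv JN J k (φ y) (mfderiv J JN φ y v) : EM) = v := by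
  obtain ⟨k, hk, hk'⟩ := h.diffeo.exists_inverse hx
  have hkd : ∀ y ∉ B, HasMFDerivAt JN J k (φ y) (mfderiv JN J k (φ y)) := fun y hy ↦
    ((hk.contMDiffAt (h.diffeo.image_mem_nhds hy)).mdifferentiableAt (by simp)).hasMFDerivAt
  refine ⟨k, hk, fun y hy ↦ hk' hy, fun y hy w ↦ ?_, fun y hy v ↦ ?_⟩
  -- The equality `k (φ y) = y` is not definitional, so the derivative is stated at every point
  -- equal to y.
  · have hφ : ∀ x', x' = y → HasMFDerivAt J JN φ x' (mfderiv J JN φ y : EM →L[ℝ] EN) := by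
      rintro _ rfl
      exact (h.mdifferentiableAt _).hasMFDerivAt
    have hc := ((hφ _ (hk' hy)).comp (φ y) (hkd y hy)).congr_of_eventuallyEq (f₁ := id) (by
      filter_upwards [h.diffeo.image_mem_nhds hy]
      rintro _ ⟨z, hz, rfl⟩
      exact congrArg φ (hk' hz).symm)
    exact congrArg (fun L : EN →L[ℝ] EN ↦ L w) (hasMFDerivAt_unique hc (hasMFDerivAt_id (φ y)))
  · have hc := ((hkd y hy).comp y (h.mdifferentiableAt y).hasMFDerivAt).congr_of_eventuallyEq
      (f₁ := id) (by
        filter_upwards [h.isClosed.isOpen_compl.mem_nhds hy] with z hz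
        exact (hk' hz).symm)
    exact congrArg (fun L : EM →L[ℝ] EM ↦ L v) (hasMFDerivAt_unique hc (hasMFDerivAt_id y))

end IsBundleInclusion

end Inclusion

/-! ### Gluing two connections along a common boundary -/

section Glue

variable {EM : Type*} [NormedAddCommGroup EM] [NormedSpace ℝ EM]
  {HM : Type*} [TopologicalSpace HM] {J : ModelWithCorners ℝ EM HM}
  {M : Type*} [TopologicalSpace M] [ChartedSpace HM M] [IsManifold J ∞ M]
  {𝕜 : Type*} [RCLike 𝕜]
  {V : Type*} [NormedAddCommGroup V] [NormedSpace ℝ V] [NormedSpace 𝕜 V] [IsScalarTower ℝ 𝕜 V]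
  {E : M → Type*} [TopologicalSpace (TotalSpace V E)] [∀ x, TopologicalSpace (E x)]
  [∀ x, AddCommGroup (E x)] [∀ x, Module ℝ (E x)] [∀ x, Module 𝕜 (E x)]
  [∀ x, IsScalarTower ℝ 𝕜 (E x)] [∀ x, IsTopologicalAddGroup (E x)] [∀ x, ContinuousSMul ℝ (E x)]
  [FiberBundle V E] [VectorBundle ℝ V E]
  {EM' : Type*} [NormedAddCommGroup EM'] [NormedSpace ℝ EM']
  {HM' : Type*} [TopologicalSpace HM'] {J' : ModelWithCorners ℝ EM' HM'}
  {M' : Type*} [TopologicalSpace M'] [ChartedSpace HM' M'] [IsManifold J' ∞ M']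
  {E' : M' → Type*} [TopologicalSpace (TotalSpace V E')] [∀ x, TopologicalSpace (E' x)]
  [∀ x, AddCommGroup (E' x)] [∀ x, Module ℝ (E' x)] [∀ x, Module 𝕜 (E' x)]
  [∀ x, IsScalarTower ℝ 𝕜 (E' x)] [∀ x, IsTopologicalAddGroup (E' x)]
  [∀ x, ContinuousSMul ℝ (E' x)] [FiberBundle V E'] [VectorBundle ℝ V E']
  {EN : Type*} [NormedAddCommGroup EN] [NormedSpace ℝ EN] [FiniteDimensional ℝ EN]
  {HN : Type*} [TopologicalSpace HN] {JN : ModelWithCorners ℝ EN HN}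
  {N : Type*} [TopologicalSpace N] [ChartedSpace HN N] [IsManifold JN ∞ N]
  {F : N → Type*} [TopologicalSpace (TotalSpace V F)] [∀ x, TopologicalSpace (F x)]
  [∀ x, AddCommGroup (F x)] [∀ x, Module ℝ (F x)] [∀ x, Module 𝕜 (F x)]
  [∀ x, IsScalarTower ℝ 𝕜 (F x)] [∀ x, IsTopologicalAddGroup (F x)] [∀ x, ContinuousSMul ℝ (F x)]
  [FiberBundle V F] [VectorBundle ℝ V F]
  {φ : M → N} {fib : ∀ x, E x ≃ₗ[𝕜] F (φ x)} {B : Set M}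
  {e : Trivialization V (π V E)} {ε : Trivialization V (π V F)}
  {φ' : M' → N} {fib' : ∀ x, E' x ≃ₗ[𝕜] F (φ' x)} {B' : Set M'}
  {e' : Trivialization V (π V E')}

namespace IsBundleInclusion

variable (h : IsBundleInclusion J JN φ fib B e ε)
include h

/-- With k a local inverse of φ, near φ x the section L is `fib ∘ τ ∘ dk`; smoothness is tested on
vector fields. -/
theorem contMDiffAt_of_pushforward (τ : FormSec J V E) {L : ∀ y : N, TangentSpace JN y →L[ℝ] F y}
    (hL : ∀ z ∉ B, ∀ v, L (φ z) (mfderiv J JN φ z v) = fib z (τ z v)) {x : M} (hx : x ∉ B) :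
    ContMDiffAt JN (JN.prod 𝓘(ℝ, EN →L[ℝ] V)) ∞
      (fun y ↦ TotalSpace.mk' (EN →L[ℝ] V) (E := fun y : N ↦ TangentSpace JN y →L[ℝ] F y)
        y (L y)) (φ x) := by
  obtain ⟨k, hk, hkφ, hdd, -⟩ := h.exists_inverse hx
  refine contMDiffAt_homSection fun X hX ↦ ?_
  have hkx : ContMDiffAt JN J ∞ k (φ x) := hk.contMDiffAt (h.diffeo.image_mem_nhds hx)
  have h1 := contMDiffAt_mfderiv_apply hkx hX
  have h2 : ContMDiffAt JN (J.prod 𝓘(ℝ, EM →L[ℝ] V)) ∞ (fun y ↦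
      TotalSpace.mk' (EM →L[ℝ] V) (E := fun y : M ↦ TangentSpace J y →L[ℝ] E y) (k y) (τ (k y)))
      (φ x) := τ.contMDiff.contMDiffAt.comp (φ x) hkx
  have h3 := h2.clm_bundle_apply h1
  have hmem : π V E ⁻¹' Bᶜ ∈ 𝓝 (⟨k (φ x), τ (k (φ x)) (mfderiv JN J k (φ x) (X (φ x)))⟩ :
      TotalSpace V E) := by
    refine (FiberBundle.continuous_proj V E).continuousAt (h.isClosed.isOpen_compl.mem_nhds ?_)
    change k (φ x) ∉ B
    rwa [hkφ x hx]
  refine ((h.fib_diffeo.1.contMDiffAt hmem).comp (φ x) h3).congr_of_eventuallyEq ?_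
  filter_upwards [h.diffeo.image_mem_nhds hx]
  rintro _ ⟨z, hz, rfl⟩
  have key : ∀ z', z' = z → ∀ v : EM, (L (φ z) (mfderiv J JN φ z v : EN) : F (φ z)) =
      fib z (τ z v) →
      (⟨φ z, L (φ z) (mfderiv J JN φ z v : EN)⟩ : TotalSpace V F) =
        ⟨φ z', fib z' (τ z' v)⟩ := by
    rintro _ rfl v hv
    rw [hv]
  have := key (k (φ z)) (hkφ z hz) (mfderiv JN J k (φ z) (X (φ z))) (hL z hz _)
  refine Eq.trans ?_ this
  exact congrArg (fun w : EN ↦ (⟨φ z, L (φ z) w⟩ : TotalSpace V F)) (hdd z hz (X (φ z))).symm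

theorem exists_pushforward (τ : FormSec J V E) {x : M} (hx : x ∉ B) :
    ∃ L : TangentSpace JN (φ x) →L[ℝ] F (φ x), ∀ v, L (mfderiv J JN φ x v) = fib x (τ x v) := by
  obtain ⟨k, -, -, -, hdd⟩ := h.exists_inverse hx
  have : FiniteDimensional ℝ (TangentSpace JN (φ x)) := inferInstanceAs (FiniteDimensional ℝ EN)
  have : T2Space (TangentSpace JN (φ x)) := inferInstanceAs (T2Space EN)
  let K : TangentSpace JN (φ x) →L[ℝ] TangentSpace J x := (mfderiv JN J k (φ x) : EN →L[ℝ] EM)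
  refine ⟨LinearMap.toContinuousLinearMap (((fib x).toLinearMap.restrictScalars ℝ) ∘ₗ
    (τ x).toLinearMap ∘ₗ K.toLinearMap), fun v ↦ ?_⟩
  exact congrArg (fun w : EM ↦ fib x (τ x w)) (hdd x hx v)

/-- This lets identities in N be checked on M at points away from B. -/
theorem exists_mfderiv_eq {x : M} (hx : x ∉ B) (w : TangentSpace JN (φ x)) :
    ∃ v : TangentSpace J x, w = mfderiv J JN φ x v := by
  obtain ⟨k, -, -, hdd, -⟩ := h.exists_inverse hx
  exact ⟨(mfderiv JN J k (φ x) w : EM), (hdd x hx w).symm⟩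

theorem mvfderiv_comp_apply {r : N → 𝕜} (hr : ContMDiff JN 𝓘(ℝ, 𝕜) ∞ r) (x : M)
    (v : TangentSpace J x) :
    mvfderiv J (r ∘ φ) x v = mvfderiv JN r (φ x) (mfderiv J JN φ x v) :=
  congrArg (fun L : EM →L[ℝ] 𝕜 ↦ L v)
    (mfderiv_comp x (hr.mdifferentiableAt (by simp)) (h.mdifferentiableAt x))

/-- A condition that holds near a boundary point of one half controls that half of a full
neighbourhood in N. Applied to both halves, it controls the whole neighbourhood. -/
theorem eventually_of_bdry {x : M} (hx : x ∈ B) {p : M → Prop} (hp : ∀ᶠ z in 𝓝 x, p z) :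
    ∀ᶠ y in 𝓝 (φ x), ∀ z, φ z = y → p z := by
  obtain ⟨t, ht, hts⟩ := mem_comap.1 (h.comap_le x hx hp)
  filter_upwards [ht] with y hy z hz
  exact hts (show φ z ∈ t by rwa [hz])

end IsBundleInclusion

/-- Connections on `E` and `E'` which are trivial near the gluing locus glue to a connection. -/
theorem exists_glued_connection (h : IsBundleInclusion J JN φ fib B e ε)
    (h' : IsBundleInclusion J' JN φ' fib' B' e' ε)
    (hB : image φ B = image φ' B') (hBB : ∀ x x', φ x = φ' x' → x ∈ B ∧ x' ∈ B')
    (hcov : range φ ∪ range φ' = univ)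
    (D : Connection J V E 𝕜) (D' : Connection J' V E' 𝕜)
    (hD : ∀ x ∈ B, ∀ᶠ y in 𝓝 x, ∀ s v, D.toFun s y v = trivialD e s y v)
    (hD' : ∀ x ∈ B', ∀ᶠ y in 𝓝 x, ∀ s v, D'.toFun s y v = trivialD e' s y v) :
    ∃ DD : Connection JN V F 𝕜,
      (∀ σ x v, DD.toFun σ (φ x) (mfderiv J JN φ x v) = fib x (D.toFun (h.pull σ) x v)) ∧
      (∀ σ x v, DD.toFun σ (φ' x) (mfderiv J' JN φ' x v) = fib' x (D'.toFun (h'.pull σ) x v)) := by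
  have hregion : ∀ y, (∃ x ∉ B, φ x = y) ∨ (∃ x ∉ B', φ' x = y) ∨ ∃ x ∈ B, φ x = y := by
    intro y
    rcases (hcov.symm ▸ mem_univ y : y ∈ range φ ∪ range φ') with ⟨x, rfl⟩ | ⟨x, rfl⟩
    · by_cases hx : x ∈ B
      · exact Or.inr (Or.inr ⟨x, hx, rfl⟩)
      · exact Or.inl ⟨x, hx, rfl⟩
    · by_cases hx : x ∈ B'
      · exact Or.inr (Or.inr (show φ' x ∈ φ '' B from hB.symm ▸ mem_image_of_mem φ' hx))
      · exact Or.inr (Or.inl ⟨x, hx, rfl⟩)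
  -- Stating the equalities in `TotalSpace` avoids casts between the fibres over y and over φ x.
  have hex : ∀ (σ : Sec JN V F) (y : N), ∃ L : TangentSpace JN y →L[ℝ] F y,
      (∀ x ∉ B, φ x = y → ∀ v : EM, (⟨y, L (mfderiv J JN φ x v : EN)⟩ : TotalSpace V F) =
        ⟨φ x, fib x (D.toFun (h.pull σ) x v)⟩) ∧
      (∀ x ∉ B', φ' x = y → ∀ v : EM', (⟨y, L (mfderiv J' JN φ' x v : EN)⟩ : TotalSpace V F) =
        ⟨φ' x, fib' x (D'.toFun (h'.pull σ) x v)⟩) ∧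
      (∀ x ∈ B, φ x = y → ∀ w, L w = trivialD ε σ y w) := by
    intro σ y
    rcases hregion y with ⟨x, hx, rfl⟩ | ⟨x, hx, rfl⟩ | ⟨x, hx, rfl⟩
    · obtain ⟨L, hL⟩ := h.exists_pushforward (D.toFun (h.pull σ)) hx
      refine ⟨L, fun z _ hzx v ↦ ?_, fun z hz hzx ↦ absurd (hBB x z hzx.symm).2 hz,
        fun z hz hzx ↦ absurd (h.injective hzx ▸ hz) hx⟩
      obtain rfl := h.injective hzx
      exact congrArg _ (hL v)
    · obtain ⟨L, hL⟩ := h'.exists_pushforward (D'.toFun (h'.pull σ)) hx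
      refine ⟨L, fun z hz hzx ↦ absurd (hBB z x hzx).1 hz, fun z _ hzx v ↦ ?_,
        fun z _ hzx ↦ absurd (hBB z x hzx).2 hx⟩
      obtain rfl := h'.injective hzx
      exact congrArg _ (hL v)
    · obtain ⟨L, hL⟩ := h.triv'.trivialD_linear σ (h.bdry_mem x hx)
      have : FiniteDimensional ℝ (TangentSpace JN (φ x)) :=
        inferInstanceAs (FiniteDimensional ℝ EN)
      have : T2Space (TangentSpace JN (φ x)) := inferInstanceAs (T2Space EN)
      exact ⟨LinearMap.toContinuousLinearMap L,
        fun z hz hzx ↦ absurd (h.injective hzx ▸ hx) hz,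
        fun z hz hzx ↦ absurd (hBB x z hzx.symm).2 hz, fun _ _ _ w ↦ hL w⟩
  choose op hop hop' hopB using hex
  have hl0 : ∀ σ, ∀ x ∉ B, ∀ v, op σ (φ x) (mfderiv J JN φ x v) =
      fib x (D.toFun (h.pull σ) x v) := fun σ x hx v ↦
    TotalSpace.mk_injective (F := V) (φ x) (hop σ (φ x) x hx rfl v)
  have hr0 : ∀ σ, ∀ x ∉ B', ∀ v, op σ (φ' x) (mfderiv J' JN φ' x v) =
      fib' x (D'.toFun (h'.pull σ) x v) := fun σ x hx v ↦
    TotalSpace.mk_injective (F := V) (φ' x) (hop' σ (φ' x) x hx rfl v)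
  have hB' : ∀ x' ∈ B', ∃ x ∈ B, φ x = φ' x' := fun x' hx' ↦ by
    simpa using (hB.symm ▸ mem_image_of_mem φ' hx' : φ' x' ∈ φ '' B)
  -- On B the operator was defined as d; since D is also d there, naturality of d extends the
  -- formula to B.
  have hl : ∀ σ x v, op σ (φ x) (mfderiv J JN φ x v) = fib x (D.toFun (h.pull σ) x v) := by
    intro σ x v
    by_cases hx : x ∈ B
    · rw [hopB σ (φ x) x hx rfl, h.trivialD_pull σ (h.bdry_mem x hx), (hD x hx).self_of_nhds]
    · exact hl0 σ x hx v
  have hr : ∀ σ x v, op σ (φ' x) (mfderiv J' JN φ' x v) =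
      fib' x (D'.toFun (h'.pull σ) x v) := by
    intro σ x v
    by_cases hx : x ∈ B'
    · obtain ⟨z, hz, hzx⟩ := hB' x hx
      rw [hopB σ (φ' x) z hz hzx, h'.trivialD_pull σ (h'.bdry_mem x hx), (hD' x hx).self_of_nhds]
    · exact hr0 σ x hx v
  refine ⟨Connection.ofLeibniz op ?_ ?_ ?_, hl, hr⟩
  · intro σ y
    rcases hregion y with ⟨x, hx, rfl⟩ | ⟨x, hx, rfl⟩ | ⟨x, hx, rfl⟩
    · exact h.contMDiffAt_of_pushforward _ (hl0 σ) hx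
    · exact h'.contMDiffAt_of_pushforward _ (hr0 σ) hx
    · refine contMDiffAt_homSection fun X hX ↦ ?_
      refine (h.triv'.contMDiffAt_trivialD σ (h.bdry_mem x hx) hX).congr_of_eventuallyEq ?_
      obtain ⟨x', hx', hxx'⟩ : ∃ x' ∈ B', φ' x' = φ x := by
        simpa using (hB ▸ mem_image_of_mem φ hx : φ x ∈ image φ' B')
      have ev' := h'.eventually_of_bdry hx' (hD' x' hx')
      rw [hxx'] at ev'
      -- Near the gluing locus the operator is d in ε, whichever half the point y comes from, and
      -- this is smooth.
      filter_upwards [h.eventually_of_bdry hx (hD x hx), ev',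
        ε.open_baseSet.mem_nhds (h.bdry_mem x hx)] with y hy hy' hyε
      congr 1
      rcases hregion y with ⟨z, hz, rfl⟩ | ⟨z, hz, rfl⟩ | ⟨z, hz, hzy⟩
      · obtain ⟨v, hv⟩ := h.exists_mfderiv_eq hz (X (φ z))
        rw [hv, hl, h.trivialD_pull σ hyε, hy z rfl]
      · obtain ⟨v, hv⟩ := h'.exists_mfderiv_eq hz (X (φ' z))
        rw [hv, hr, h'.trivialD_pull σ hyε, hy' z rfl]
      · exact hopB σ y z hz hzy _
  · intro σ τ y w
    rcases hregion y with ⟨z, hz, rfl⟩ | ⟨z, hz, rfl⟩ | ⟨z, hz, rfl⟩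
    · obtain ⟨v, rfl⟩ := h.exists_mfderiv_eq hz w
      simp only [hl, h.pull_add, D.map_add_apply, map_add]
    · obtain ⟨v, rfl⟩ := h'.exists_mfderiv_eq hz w
      simp only [hr, h'.pull_add, D'.map_add_apply, map_add]
    · simp only [hopB _ _ z hz rfl, h.triv'.trivialD_add σ τ (h.bdry_mem z hz)]
  · intro r hrs σ τ hτ y w
    rcases hregion y with ⟨z, hz, rfl⟩ | ⟨z, hz, rfl⟩ | ⟨z, hz, rfl⟩
    · obtain ⟨v, rfl⟩ := h.exists_mfderiv_eq hz w
      rw [hl, hl, D.leibniz_mvfderiv (hrs.comp h.smooth) (h.pull_smul hτ), map_add, map_smul,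
        map_smul, h.fib_pull, h.mvfderiv_comp_apply hrs]
      rfl
    · obtain ⟨v, rfl⟩ := h'.exists_mfderiv_eq hz w
      rw [hr, hr, D'.leibniz_mvfderiv (hrs.comp h'.smooth) (h'.pull_smul hτ), map_add, map_smul,
        map_smul, h'.fib_pull, h'.mvfderiv_comp_apply hrs]
      rfl
    · simp only [hopB _ _ z hz rfl, h.triv'.trivialD_leibniz hrs hτ (h.bdry_mem z hz)]

end Glue

/-! ### Trivializations from a fibre coordinate and its inverse -/

section MkTriv

variable {EN : Type*} [NormedAddCommGroup EN] [NormedSpace ℝ EN]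
  {HN : Type*} [TopologicalSpace HN] {JN : ModelWithCorners ℝ EN HN}
  {N : Type*} [TopologicalSpace N] [ChartedSpace HN N]
  {𝕜 : Type*} [RCLike 𝕜]
  {V : Type*} [NormedAddCommGroup V] [NormedSpace ℝ V] [NormedSpace 𝕜 V]
  {F : N → Type*} [TopologicalSpace (TotalSpace V F)] [∀ x, TopologicalSpace (F x)]
  [∀ x, AddCommGroup (F x)] [∀ x, Module ℝ (F x)] [∀ x, Module 𝕜 (F x)]
  [FiberBundle V F] [VectorBundle ℝ V F] [ContMDiffVectorBundle ∞ V F JN]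

/-- A smooth trivialization from its fibre coordinate `u` and the inverse map `T`. -/
theorem exists_isSmoothTriv {U : Set N} (hU : IsOpen U) {u : TotalSpace V F → V}
    {T : N × V → TotalSpace V F}
    (hℓ : ∀ y ∈ U, ∃ ℓ : V ≃ₗ[𝕜] F y, ∀ v, T (y, v) = ⟨y, ℓ v⟩ ∧ u ⟨y, ℓ v⟩ = v)
    (hu : ContMDiffOn (JN.prod 𝓘(ℝ, V)) 𝓘(ℝ, V) ∞ u (π V F ⁻¹' U))
    (hT : ContMDiffOn (JN.prod 𝓘(ℝ, V)) (JN.prod 𝓘(ℝ, V)) ∞ T (U ×ˢ univ)) :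
    ∃ ε : Trivialization V (π V F), IsSmoothTriv JN 𝕜 ε ∧ ε.baseSet = U ∧
      ∀ p, (ε p).2 = u p := by
  have hu' : ContMDiffOn (JN.prod 𝓘(ℝ, V)) (JN.prod 𝓘(ℝ, V)) ∞
      (fun p : TotalSpace V F ↦ (p.1, u p)) (π V F ⁻¹' U) := (contMDiffOn_proj F).prodMk hu
  let ε : Trivialization V (π V F) :=
    { toFun := fun p ↦ (p.1, u p)
      invFun := T
      source := π V F ⁻¹' U
      target := U ×ˢ univ
      map_source' := fun p hp ↦ ⟨hp, mem_univ _⟩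
      map_target' := by
        rintro ⟨y, v⟩ ⟨hy, -⟩
        obtain ⟨ℓ, hℓ⟩ := hℓ y hy
        rw [(hℓ v).1]
        exact hy
      left_inv' := by
        rintro ⟨y, z⟩ hy
        obtain ⟨ℓ, hℓ⟩ := hℓ y hy
        obtain ⟨v, rfl⟩ := ℓ.surjective z
        rw [(hℓ v).2, (hℓ v).1]
      right_inv' := by
        rintro ⟨y, v⟩ ⟨hy, -⟩
        obtain ⟨ℓ, hℓ⟩ := hℓ y hy
        simp only [(hℓ v).1, (hℓ v).2]
      open_source := hU.preimage (FiberBundle.continuous_proj V F)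
      open_target := hU.prod isOpen_univ
      continuousOn_toFun := hu'.continuousOn
      continuousOn_invFun := hT.continuousOn
      baseSet := U
      open_baseSet := hU
      source_eq := rfl
      target_eq := rfl
      proj_toFun := fun p _ ↦ rfl }
  refine ⟨ε, ⟨⟨fun y hy ↦ ?_⟩, hu', hT⟩, rfl, fun p ↦ rfl⟩
  obtain ⟨ℓ, hℓ⟩ := hℓ y hy
  have : (fun z : F y ↦ (ε ⟨y, z⟩).2) = ℓ.symm := by
    funext z
    obtain ⟨v, rfl⟩ := ℓ.surjective z
    exact (hℓ v).2.trans (ℓ.symm_apply_apply v).symm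
  rw [this]
  exact ℓ.symm.toLinearMap.isLinear

end MkTriv

/-! ### Bundle inclusions from bicollars -/

section Collar

variable {EW : Type*} [NormedAddCommGroup EW] [NormedSpace ℝ EW]
  {HW : Type*} [TopologicalSpace HW] {IW : ModelWithCorners ℝ EW HW}
  {W : Type*} [TopologicalSpace W] [ChartedSpace HW W]
  {EM : Type*} [NormedAddCommGroup EM] [NormedSpace ℝ EM]
  {HM : Type*} [TopologicalSpace HM] {J : ModelWithCorners ℝ EM HM}
  {M : Type*} [TopologicalSpace M] [ChartedSpace HM M]
  {𝕜 : Type*} [RCLike 𝕜]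
  {V : Type*} [NormedAddCommGroup V] [NormedSpace ℝ V] [NormedSpace 𝕜 V]
  {E : M → Type*} [TopologicalSpace (TotalSpace V E)] [∀ x, TopologicalSpace (E x)]
  [∀ x, AddCommGroup (E x)] [∀ x, Module 𝕜 (E x)] [FiberBundle V E]
  {EN : Type*} [NormedAddCommGroup EN] [NormedSpace ℝ EN]
  {HN : Type*} [TopologicalSpace HN] {JN : ModelWithCorners ℝ EN HN}
  {N : Type*} [TopologicalSpace N] [ChartedSpace HN N]
  {F : N → Type*} [TopologicalSpace (TotalSpace V F)] [∀ x, TopologicalSpace (F x)]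
  [∀ x, AddCommGroup (F x)] [∀ x, Module 𝕜 (F x)] [FiberBundle V F]
  {φ : M → N} {fib : ∀ x, E x ≃ₗ[𝕜] F (φ x)}
  {e : Trivialization V (π V E)} {ε : Trivialization V (π V F)}

/-- A bundle map that is an open embedding away from the boundary and extends over a bicollar
`n` of the collar `k` is a bundle inclusion. -/
theorem isBundleInclusion_of_collar {k : W × ℝ → M} {n : W × ℝ → N} {S S' : Set ℝ}
    (h0 : (0 : ℝ) ∈ S) (hS' : IsOpen S') (hSS' : S ⊆ S')
    (hk : IsOpenDiffeoOn (IW.prod 𝓘(ℝ, ℝ)) J k (univ ×ˢ S))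
    (hn : IsOpenDiffeoOn (IW.prod 𝓘(ℝ, ℝ)) JN n (univ ×ˢ S'))
    (hnk : ∀ q, q.2 ∈ S → n q = φ (k q))
    (hcross : ∀ q, q.2 ∈ S' → ∀ x, φ x = n q → q.2 ∈ S ∧ x = k q)
    (hinj : φ.Injective)
    (hcl : IsClosed (range fun w ↦ k (w, 0)))
    (hφ : IsOpenDiffeoOn J JN φ (range fun w ↦ k (w, 0))ᶜ)
    (hfib : IsOpenDiffeoOn (J.prod 𝓘(ℝ, V)) (JN.prod 𝓘(ℝ, V))
      (fun p : TotalSpace V E ↦ (⟨φ p.1, fib p.1 p.2⟩ : TotalSpace V F))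
      (π V E ⁻¹' (range fun w ↦ k (w, 0))ᶜ))
    (he : IsSmoothTriv J 𝕜 e) (hε : IsSmoothTriv JN 𝕜 ε)
    (hke : k '' (univ ×ˢ S) ⊆ e.baseSet) (hnε : ε.baseSet = n '' (univ ×ˢ S'))
    (hfe : ∀ q, q.2 ∈ S → ∀ v, (ε ⟨φ (k q), fib (k q) (e.symm (k q) v)⟩).2 = v) :
    IsBundleInclusion J JN φ fib (range fun w ↦ k (w, 0)) e ε := by
  have hmem : ∀ x, φ x ∈ ε.baseSet → ∃ q, q.2 ∈ S ∧ k q = x := by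
    intro x hx
    rw [hnε] at hx
    obtain ⟨q, ⟨-, hq⟩, hqx⟩ := hx
    have := hcross q hq x hqx.symm
    exact ⟨q, this.1, this.2.symm⟩
  have hemem : ∀ q, q.2 ∈ S → k q ∈ e.baseSet := fun q hq ↦
    hke (mem_image_of_mem k ⟨mem_univ _, hq⟩)
  refine ⟨hinj, fun x ↦ ?_, hcl, hφ, hfib, he, hε, fun x hx ↦ ?_, ?_, fun x hx z ↦ ?_, ?_⟩
  · by_cases hx : x ∈ range fun w ↦ k (w, 0)
    · obtain ⟨w, rfl⟩ := hx
      have hw : (w, (0 : ℝ)) ∈ (univ : Set W) ×ˢ S := ⟨mem_univ _, h0⟩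
      -- Near the boundary φ = n ∘ k⁻¹, and n is smooth across height 0.
      obtain ⟨j, hj, hjk⟩ := hk.exists_inverse hw
      have h1 := hj.contMDiffAt (hk.image_mem_nhds hw)
      have h2 : ContMDiffAt (IW.prod 𝓘(ℝ, ℝ)) JN ∞ n (j (k (w, 0))) := by
        rw [hjk hw]
        exact hn.1.contMDiffAt ((isOpen_univ.prod hS').mem_nhds ⟨mem_univ _, hSS' h0⟩)
      refine (h2.comp _ h1).congr_of_eventuallyEq ?_
      filter_upwards [hk.image_mem_nhds hw]
      rintro _ ⟨q, hq, rfl⟩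
      rw [Function.comp_apply, hjk hq, hnk q hq.2]
    · exact hφ.1.contMDiffAt (hcl.isOpen_compl.mem_nhds hx)
  · obtain ⟨q, hq, rfl⟩ := hmem x hx
    exact hemem q hq
  · rintro _ ⟨w, rfl⟩
    rw [hnε]
    exact ⟨(w, 0), ⟨mem_univ _, hSS' h0⟩, hnk _ h0⟩
  · obtain ⟨q, hq, rfl⟩ := hmem x hx
    have := hfe q hq (e ⟨k q, z⟩).2
    rwa [e.symm_apply_apply_mk (hemem q hq)] at this
  · rintro _ ⟨w, rfl⟩ O hO
    have hw : (w, (0 : ℝ)) ∈ (univ : Set W) ×ˢ S := ⟨mem_univ _, h0⟩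
    have hw' : (w, (0 : ℝ)) ∈ (univ : Set W) ×ˢ S' := ⟨mem_univ _, hSS' h0⟩
    obtain ⟨m, hm, hmn⟩ := hn.exists_inverse hw'
    have h1 := (hm.contMDiffAt (hn.image_mem_nhds hw')).continuousAt
    -- The collar map k is continuous only within W × S, hence the implication; `hcross` ensures
    -- that points of M in the bicollar have height in S.
    have h2 : {q : W × ℝ | q ∈ (univ : Set W) ×ˢ S → k q ∈ O} ∈ 𝓝 (m (n (w, 0))) := by
      rw [hmn hw']
      exact mem_nhdsWithin_iff_eventually.1 (hk.1.continuousOn (w, 0) hw hO)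
    change _ ∈ comap φ (𝓝 (φ (k (w, 0))))
    rw [← hnk _ h0]
    refine ⟨_, inter_mem (h1 h2) (hn.image_mem_nhds hw'), ?_⟩
    rintro z ⟨hz1, q, hq, hqz⟩
    obtain ⟨hqS, rfl⟩ := hcross q hq.2 z hqz.symm
    rw [mem_preimage, ← hqz] at hz1
    change m (n q) ∈ {q | _} at hz1
    rw [hmn hq] at hz1
    exact hz1 ⟨mem_univ _, hqS⟩

end Collar

/-! ### The bicollar of a gluing and the two inclusions -/

section Gluing

variable {EW : Type*} [NormedAddCommGroup EW] [NormedSpace ℝ EW]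
  {HW : Type*} [TopologicalSpace HW] {IW : ModelWithCorners ℝ EW HW}
  {W₀ : Type*} [TopologicalSpace W₀] [ChartedSpace HW W₀]
  {W₁ : Type*} [TopologicalSpace W₁] [ChartedSpace HW W₁]
  {W₂ : Type*} [TopologicalSpace W₂] [ChartedSpace HW W₂]
  {EM : Type*} [NormedAddCommGroup EM] [NormedSpace ℝ EM]
  {HM : Type*} [TopologicalSpace HM] {J : ModelWithCorners ℝ EM HM}
  {M : Type*} [TopologicalSpace M] [ChartedSpace HM M]
  {𝕜 : Type*} [RCLike 𝕜]
  {V : Type*} [NormedAddCommGroup V] [NormedSpace ℝ V] [NormedSpace 𝕜 V]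
  {E : M → Type*} [TopologicalSpace (TotalSpace V E)] [∀ x, TopologicalSpace (E x)]
  [∀ x, AddCommGroup (E x)] [∀ x, Module 𝕜 (E x)] [FiberBundle V E]
  {EM' : Type*} [NormedAddCommGroup EM'] [NormedSpace ℝ EM']
  {HM' : Type*} [TopologicalSpace HM'] {J' : ModelWithCorners ℝ EM' HM'}
  {M' : Type*} [TopologicalSpace M'] [ChartedSpace HM' M']
  {E' : M' → Type*} [TopologicalSpace (TotalSpace V E')] [∀ x, TopologicalSpace (E' x)]
  [∀ x, AddCommGroup (E' x)] [∀ x, Module 𝕜 (E' x)] [FiberBundle V E']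
  {EN : Type*} [NormedAddCommGroup EN] [NormedSpace ℝ EN]
  {HN : Type*} [TopologicalSpace HN] {JN : ModelWithCorners ℝ EN HN}
  {N : Type*} [TopologicalSpace N] [ChartedSpace HN N]
  {F : N → Type*} [TopologicalSpace (TotalSpace V F)] [∀ x, TopologicalSpace (F x)]
  [∀ x, AddCommGroup (F x)] [∀ x, Module 𝕜 (F x)] [FiberBundle V F]
  {c : BundleCobordism IW W₀ W₁ J 𝕜 V E} {c' : BundleCobordism IW W₁ W₂ J' 𝕜 V E'}
  (g : BundleGluing JN F c c')

namespace BundleGluing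

/-- The bicollar of the gluing. -/
def neck (q : W₁ × ℝ) : N := if q.2 ≤ 0 then g.inl (c.outC q) else g.inr (c'.inC q)

/-- The trivial bundle over the bicollar, mapped to the glued bundle. -/
def neckMap (p : (W₁ × ℝ) × V) : TotalSpace V F :=
  if p.1.2 ≤ 0 then ⟨g.inl (c.outC p.1), g.fibl _ (c.triv.symm (c.outC p.1) p.2)⟩
  else ⟨g.inr (c'.inC p.1), g.fibr _ (c'.triv.symm (c'.inC p.1) p.2)⟩

theorem image_outBdry : g.inl '' c.outBdry = g.inr '' c'.inBdry := by
  have h : ∀ w, g.inl (c.outC (w, 0)) = g.inr (c'.inC (w, 0)) := fun w ↦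
    (g.inl_eq_inr_iff _ _).2 ⟨w, rfl, rfl⟩
  ext y
  constructor
  · rintro ⟨_, ⟨w, rfl⟩, rfl⟩
    exact ⟨_, ⟨w, rfl⟩, (h w).symm⟩
  · rintro ⟨_, ⟨w, rfl⟩, rfl⟩
    exact ⟨_, ⟨w, rfl⟩, h w⟩

theorem neck_of_nonpos {q : W₁ × ℝ} (hq : q.2 ≤ 0) : g.neck q = g.inl (c.outC q) := if_pos hq

/-- The definition takes the M side at height 0; the identification through W₁ makes the M' formula
valid there as well. -/
theorem neck_of_nonneg {q : W₁ × ℝ} (hq : 0 ≤ q.2) : g.neck q = g.inr (c'.inC q) := by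
  rcases hq.eq_or_lt with h | h
  · rw [g.neck_of_nonpos h.symm.le]
    obtain ⟨w, t⟩ := q
    obtain rfl : 0 = t := h
    exact (g.inl_eq_inr_iff _ _).2 ⟨w, rfl, rfl⟩
  · exact if_neg h.not_ge

theorem neckMap_of_nonpos {q : W₁ × ℝ} (hq : q.2 ≤ 0) (v : V) : g.neckMap (q, v) =
    ⟨g.inl (c.outC q), g.fibl _ (c.triv.symm (c.outC q) v)⟩ := if_pos hq

theorem neckMap_of_nonneg {q : W₁ × ℝ} (hq : 0 ≤ q.2) (v : V) : g.neckMap (q, v) =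
    ⟨g.inr (c'.inC q), g.fibr _ (c'.triv.symm (c'.inC q) v)⟩ := by
  rcases hq.eq_or_lt with h | h
  · rw [g.neckMap_of_nonpos h.symm.le]
    obtain ⟨w, t⟩ := q
    obtain rfl : 0 = t := h
    exact g.fib_match w v
  · exact if_neg h.not_ge

theorem outC_mem {q : W₁ × ℝ} (hq : q.2 ∈ Ioc (-1 : ℝ) 0) : c.outC q ∈ c.triv.baseSet := by
  rw [c.triv_baseSet]
  exact Or.inr (mem_image_of_mem _ ⟨mem_univ _, hq⟩)

theorem inC_mem {q : W₁ × ℝ} (hq : q.2 ∈ Ico (0 : ℝ) 1) : c'.inC q ∈ c'.triv.baseSet := by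
  rw [c'.triv_baseSet]
  exact Or.inl (mem_image_of_mem _ ⟨mem_univ _, hq⟩)

theorem exists_neckMap_eq {q : W₁ × ℝ} (hq : q.2 ∈ Ioo (-1 : ℝ) 1) :
    ∃ ℓ : V ≃ₗ[𝕜] F (g.neck q), ∀ v, g.neckMap (q, v) = ⟨g.neck q, ℓ v⟩ := by
  rcases le_total q.2 0 with h | h
  · have hlin := c.triv_linear
    rw [g.neck_of_nonpos h]
    exact ⟨(c.triv.linearEquivAt 𝕜 _ (outC_mem ⟨hq.1, h⟩)).symm.trans (g.fibl _),
      fun v ↦ g.neckMap_of_nonpos h v⟩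
  · have hlin := c'.triv_linear
    rw [g.neck_of_nonneg h]
    exact ⟨(c'.triv.linearEquivAt 𝕜 _ (inC_mem ⟨h, hq.2⟩)).symm.trans (g.fibr _),
      fun v ↦ g.neckMap_of_nonneg h v⟩

theorem neckMap_isOpenDiffeoOn : IsOpenDiffeoOn ((IW.prod 𝓘(ℝ, ℝ)).prod 𝓘(ℝ, V))
    (JN.prod 𝓘(ℝ, V)) g.neckMap ((univ ×ˢ Ioo (-1) 1) ×ˢ univ) := g.neck_triv_diffeo

theorem neck_isOpenDiffeoOn : IsOpenDiffeoOn (IW.prod 𝓘(ℝ, ℝ)) JN g.neck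
    (univ ×ˢ Ioo (-1) 1) := g.neck_diffeo

/-- Each fibre V is mapped onto the whole fibre of F, so the image is a full preimage, the required
source of a trivialization. -/
theorem neckMap_image : g.neckMap '' ((univ ×ˢ Ioo (-1) 1) ×ˢ univ) =
    π V F ⁻¹' (g.neck '' (univ ×ˢ Ioo (-1) 1)) := by
  ext ⟨y, z⟩
  constructor
  · rintro ⟨⟨q, v⟩, ⟨hq, -⟩, hqv⟩
    obtain ⟨ℓ, hℓ⟩ := g.exists_neckMap_eq hq.2
    rw [hℓ v] at hqv
    exact ⟨q, hq, congrArg TotalSpace.proj hqv⟩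
  · rintro ⟨q, hq, rfl⟩
    obtain ⟨ℓ, hℓ⟩ := g.exists_neckMap_eq hq.2
    obtain ⟨v, rfl⟩ := ℓ.surjective z
    exact ⟨(q, v), ⟨hq, mem_univ _⟩, hℓ v⟩

/-- The trivialization of the glued bundle over the bicollar. -/
theorem exists_neck_triv [∀ x, Module ℝ (F x)] [VectorBundle ℝ V F]
    [ContMDiffVectorBundle ∞ V F JN] :
    ∃ ε : Trivialization V (π V F), IsSmoothTriv JN 𝕜 ε ∧
      ε.baseSet = g.neck '' (univ ×ˢ Ioo (-1) 1) ∧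
      ∀ q : W₁ × ℝ, q.2 ∈ Ioo (-1 : ℝ) 1 → ∀ v, (ε (g.neckMap (q, v))).2 = v := by
  have hu : ∃ u : TotalSpace V F → V,
      ContMDiffOn (JN.prod 𝓘(ℝ, V)) 𝓘(ℝ, V) ∞ u (π V F ⁻¹' (g.neck '' (univ ×ˢ Ioo (-1) 1))) ∧
      ∀ q : W₁ × ℝ, q.2 ∈ Ioo (-1 : ℝ) 1 → ∀ v, u (g.neckMap (q, v)) = v := by
    -- A smooth inverse is only provided for a nonempty bicollar; if W₁ is empty, any function
    -- serves.
    rcases isEmpty_or_nonempty W₁ with hW | ⟨⟨w⟩⟩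
    · exact ⟨fun _ ↦ 0, contMDiffOn_const, fun q ↦ isEmptyElim q.1⟩
    · obtain ⟨h, hh, hh'⟩ := g.neckMap_isOpenDiffeoOn.exists_inverse
        (x := ((w, (0 : ℝ)), (0 : V))) (by simp)
      rw [neckMap_image] at hh
      exact ⟨fun p ↦ (h p).2, contMDiff_snd.comp_contMDiffOn hh,
        fun q hq v ↦ congrArg Prod.snd (hh' (x := (q, v)) ⟨⟨mem_univ _, hq⟩, mem_univ _⟩)⟩
  have hT : ∃ T : N × V → TotalSpace V F,
      ContMDiffOn (JN.prod 𝓘(ℝ, V)) (JN.prod 𝓘(ℝ, V)) ∞ T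
        ((g.neck '' (univ ×ˢ Ioo (-1) 1)) ×ˢ univ) ∧
      ∀ q : W₁ × ℝ, q.2 ∈ Ioo (-1 : ℝ) 1 → ∀ v, T (g.neck q, v) = g.neckMap (q, v) := by
    rcases isEmpty_or_nonempty W₁ with hW | ⟨⟨w⟩⟩
    · refine ⟨fun p ↦ ⟨p.1, 0⟩, ?_, fun q ↦ isEmptyElim q.1⟩
      rintro _ ⟨⟨q, -⟩, -⟩
      exact isEmptyElim q.1
    · obtain ⟨h, hh, hh'⟩ := g.neck_isOpenDiffeoOn.exists_inverse (x := (w, (0 : ℝ))) (by simp)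
      refine ⟨fun p ↦ g.neckMap (h p.1, p.2), ?_, fun q hq v ↦ ?_⟩
      · refine g.neckMap_isOpenDiffeoOn.1.comp
          ((hh.comp contMDiffOn_fst fun p hp ↦ hp.1).prodMk contMDiffOn_snd) ?_
        rintro ⟨_, v⟩ ⟨⟨q, hq, rfl⟩, -⟩
        simpa [hh' hq] using hq
      · simp only [hh' (x := q) ⟨mem_univ _, hq⟩]
  obtain ⟨u, hus, hu⟩ := hu
  obtain ⟨T, hTs, hT⟩ := hT
  obtain ⟨ε, hε, hb, hεu⟩ := exists_isSmoothTriv (𝕜 := 𝕜) g.neck_isOpenDiffeoOn.2.1 (u := u)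
    (T := T) (by
      rintro _ ⟨q, ⟨-, hq⟩, rfl⟩
      obtain ⟨ℓ, hℓ⟩ := g.exists_neckMap_eq hq
      refine ⟨ℓ, fun v ↦ ⟨(hT q hq v).trans (hℓ v), ?_⟩⟩
      rw [← hℓ v]
      exact hu q hq v) hus hTs
  exact ⟨ε, hε, hb, fun q hq v ↦ (hεu _).trans (hu q hq v)⟩

theorem isBundleInclusion_inl [CompactSpace W₁] [T2Space M] {ε : Trivialization V (π V F)}
    (hε : IsSmoothTriv JN 𝕜 ε) (hb : ε.baseSet = g.neck '' (univ ×ˢ Ioo (-1) 1))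
    (hεn : ∀ q : W₁ × ℝ, q.2 ∈ Ioo (-1 : ℝ) 1 → ∀ v, (ε (g.neckMap (q, v))).2 = v) :
    IsBundleInclusion J JN g.inl g.fibl c.outBdry c.triv ε := by
  refine isBundleInclusion_of_collar (k := c.outC) (n := g.neck) (S := Ioc (-1) 0)
    (S' := Ioo (-1) 1) (by simp) isOpen_Ioo (fun t ht ↦ ⟨ht.1, ht.2.trans_lt one_pos⟩)
    c.outC_diffeo g.neck_isOpenDiffeoOn (fun q hq ↦ g.neck_of_nonpos hq.2) ?_ g.inl_injective
    c.isClosed_outBdry g.inl_diffeo g.fibl_diffeo c.isSmoothTriv hε ?_ hb ?_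
  · intro q hq x hx
    rcases le_or_gt q.2 0 with h | h
    · rw [g.neck_of_nonpos h] at hx
      exact ⟨⟨hq.1, h⟩, g.inl_injective hx⟩
    · rw [g.neck_of_nonneg h.le] at hx
      -- A point of M' that also lies in M is on W₁; injectivity of the collar then puts q at height
      -- 0.
      obtain ⟨w, -, hw⟩ := (g.inl_eq_inr_iff _ _).1 hx
      have := c'.inC_diffeo.injOn (x₁ := q) ⟨mem_univ _, h.le, hq.2⟩ (x₂ := (w, 0)) (by simp) hw
      rw [this] at h
      exact absurd h (lt_irrefl _)
  · rw [c.triv_baseSet]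
    exact subset_union_right
  · intro q hq v
    rw [← g.neckMap_of_nonpos hq.2]
    exact hεn q ⟨hq.1, hq.2.trans_lt one_pos⟩ v

theorem isBundleInclusion_inr [CompactSpace W₁] [T2Space M'] {ε : Trivialization V (π V F)}
    (hε : IsSmoothTriv JN 𝕜 ε) (hb : ε.baseSet = g.neck '' (univ ×ˢ Ioo (-1) 1))
    (hεn : ∀ q : W₁ × ℝ, q.2 ∈ Ioo (-1 : ℝ) 1 → ∀ v, (ε (g.neckMap (q, v))).2 = v) :
    IsBundleInclusion J' JN g.inr g.fibr c'.inBdry c'.triv ε := by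
  have hneg : (-1 : ℝ) < 0 := by norm_num
  refine isBundleInclusion_of_collar (k := c'.inC) (n := g.neck) (S := Ico 0 1)
    (S' := Ioo (-1) 1) (by simp) isOpen_Ioo (fun t ht ↦ ⟨hneg.trans_le ht.1, ht.2⟩)
    c'.inC_diffeo g.neck_isOpenDiffeoOn (fun q hq ↦ g.neck_of_nonneg hq.1) ?_ g.inr_injective
    c'.isClosed_inBdry g.inr_diffeo g.fibr_diffeo c'.isSmoothTriv hε ?_ hb ?_
  · intro q hq x hx
    rcases le_or_gt 0 q.2 with h | h
    · rw [g.neck_of_nonneg h] at hx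
      exact ⟨⟨h, hq.2⟩, g.inr_injective hx⟩
    · rw [g.neck_of_nonpos h.le] at hx
      obtain ⟨w, hw, -⟩ := (g.inl_eq_inr_iff _ _).1 hx.symm
      have := c.outC_diffeo.injOn (x₁ := q) ⟨mem_univ _, hq.1, h.le⟩ (x₂ := (w, 0)) (by simp) hw
      rw [this] at h
      exact absurd h (lt_irrefl _)
  · rw [c'.triv_baseSet]
    exact subset_union_left
  · intro q hq v
    rw [← g.neckMap_of_nonneg hq.1]
    exact hεn q ⟨hneg.trans_le hq.1, hq.2⟩ v

end BundleGluing

end Gluing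

end BundleGlue

end

/-! ### The glued connection -/

theorem mainTheorem6
    {𝕜 : Type*} [RCLike 𝕜]
    -- the fibre
    {V : Type*} [NormedAddCommGroup V] [NormedSpace ℝ V] [NormedSpace 𝕜 V] [IsScalarTower ℝ 𝕜 V]
    [FiniteDimensional 𝕜 V]
    -- the objects
    {EW : Type*} [NormedAddCommGroup EW] [NormedSpace ℝ EW] [FiniteDimensional ℝ EW]
    {HW : Type*} [TopologicalSpace HW] {IW : ModelWithCorners ℝ EW HW}
    {W₀ : Type*} [TopologicalSpace W₀] [ChartedSpace HW W₀] [IsManifold IW ∞ W₀]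
    [CompactSpace W₀] [T2Space W₀]
    {W₁ : Type*} [TopologicalSpace W₁] [ChartedSpace HW W₁] [IsManifold IW ∞ W₁]
    [CompactSpace W₁] [T2Space W₁]
    {W₂ : Type*} [TopologicalSpace W₂] [ChartedSpace HW W₂] [IsManifold IW ∞ W₂]
    [CompactSpace W₂] [T2Space W₂]
    -- the compact manifold `M` and the vector bundle `E → M`
    {EM : Type*} [NormedAddCommGroup EM] [NormedSpace ℝ EM] [FiniteDimensional ℝ EM]
    {HM : Type*} [TopologicalSpace HM] {J : ModelWithCorners ℝ EM HM}
    {M : Type*} [TopologicalSpace M] [ChartedSpace HM M] [IsManifold J ∞ M]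
    [CompactSpace M] [T2Space M]
    {E : M → Type*} [TopologicalSpace (TotalSpace V E)] [∀ x, TopologicalSpace (E x)]
    [∀ x, AddCommGroup (E x)] [∀ x, Module ℝ (E x)] [∀ x, Module 𝕜 (E x)]
    [∀ x, IsScalarTower ℝ 𝕜 (E x)]
    [∀ x, IsTopologicalAddGroup (E x)] [∀ x, ContinuousSMul ℝ (E x)]
    [FiberBundle V E] [VectorBundle ℝ V E] [VectorBundle 𝕜 V E] [ContMDiffVectorBundle ∞ V E J]
    -- the compact manifold `M'` and the vector bundle `E' → M'`
    {EM' : Type*} [NormedAddCommGroup EM'] [NormedSpace ℝ EM'] [FiniteDimensional ℝ EM']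
    {HM' : Type*} [TopologicalSpace HM'] {J' : ModelWithCorners ℝ EM' HM'}
    {M' : Type*} [TopologicalSpace M'] [ChartedSpace HM' M'] [IsManifold J' ∞ M']
    [CompactSpace M'] [T2Space M']
    {E' : M' → Type*} [TopologicalSpace (TotalSpace V E')] [∀ x, TopologicalSpace (E' x)]
    [∀ x, AddCommGroup (E' x)] [∀ x, Module ℝ (E' x)] [∀ x, Module 𝕜 (E' x)]
    [∀ x, IsScalarTower ℝ 𝕜 (E' x)]
    [∀ x, IsTopologicalAddGroup (E' x)] [∀ x, ContinuousSMul ℝ (E' x)]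
    [FiberBundle V E'] [VectorBundle ℝ V E'] [VectorBundle 𝕜 V E']
    [ContMDiffVectorBundle ∞ V E' J']
    -- the manifold `N = M' * M` and the vector bundle `F = E' * E → N`
    {EN : Type*} [NormedAddCommGroup EN] [NormedSpace ℝ EN] [FiniteDimensional ℝ EN]
    {HN : Type*} [TopologicalSpace HN] {JN : ModelWithCorners ℝ EN HN}
    {N : Type*} [TopologicalSpace N] [ChartedSpace HN N] [IsManifold JN ∞ N]
    {F : N → Type*} [TopologicalSpace (TotalSpace V F)] [∀ x, TopologicalSpace (F x)]
    [∀ x, AddCommGroup (F x)] [∀ x, Module ℝ (F x)] [∀ x, Module 𝕜 (F x)]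
    [∀ x, IsScalarTower ℝ 𝕜 (F x)]
    [∀ x, IsTopologicalAddGroup (F x)] [∀ x, ContinuousSMul ℝ (F x)]
    [FiberBundle V F] [VectorBundle ℝ V F] [VectorBundle 𝕜 V F] [ContMDiffVectorBundle ∞ V F JN]
    -- the bundle cobordisms, their gluing, and the connections
    (c : BundleGlue.BundleCobordism IW W₀ W₁ J 𝕜 V E)
    (c' : BundleGlue.BundleCobordism IW W₁ W₂ J' 𝕜 V E')
    (g : BundleGlue.BundleGluing JN F c c')
    (D : BundleGlue.Connection J V E 𝕜) (D' : BundleGlue.Connection J' V E' 𝕜) :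
    -- bump functions exist
    (∃ f, c.IsBump f) ∧ (∃ f', c'.IsBump f') ∧
    -- and for all bump functions the connection `d + f A_∇ + f' A_∇'` exists on `E' * E`
    ∀ f f', c.IsBump f → c'.IsBump f' → ∃ DD : BundleGlue.Connection JN V F 𝕜,
      (∀ (σ : BundleGlue.Sec JN V F) (s : BundleGlue.Sec J V E) (x : M),
        (∀ᶠ y in 𝓝 x, σ (g.inl y) = g.fibl y (s y)) → ∀ v : TangentSpace J x,
          (x ∈ c.collar → DD.toFun σ (g.inl x) (mfderiv J JN g.inl x v) =
            g.fibl x (D.scaled c.triv f s x v)) ∧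
          (x ∉ c.collar → DD.toFun σ (g.inl x) (mfderiv J JN g.inl x v) =
            g.fibl x (D.toFun s x v))) ∧
      (∀ (σ : BundleGlue.Sec JN V F) (s : BundleGlue.Sec J' V E') (x : M'),
        (∀ᶠ y in 𝓝 x, σ (g.inr y) = g.fibr y (s y)) → ∀ v : TangentSpace J' x,
          (x ∈ c'.collar → DD.toFun σ (g.inr x) (mfderiv J' JN g.inr x v) =
            g.fibr x (D'.scaled c'.triv f' s x v)) ∧
          (x ∉ c'.collar → DD.toFun σ (g.inr x) (mfderiv J' JN g.inr x v) =
            g.fibr x (D'.toFun s x v))) := by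
  refine ⟨c.exists_isBump, c'.exists_isBump, fun f f' hf hf' ↦ ?_⟩
  obtain ⟨ε, hε, hb, hεn⟩ := g.exists_neck_triv
  have hl := g.isBundleInclusion_inl hε hb hεn
  have hr := g.isBundleInclusion_inr hε hb hεn
  have hc : c.triv.baseSet = c.collar := c.triv_baseSet
  have hc' : c'.triv.baseSet = c'.collar := c'.triv_baseSet
  obtain ⟨Df, hDf, hDf'⟩ := D.exists_scaled c.isSmoothTriv hf.smooth (hc ▸ hf.eq_one)
  obtain ⟨Df₂, hDf₂, hDf₂'⟩ := D'.exists_scaled c'.isSmoothTriv hf'.smooth (hc' ▸ hf'.eq_one)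
  -- Vanishing of f near the outgoing boundary removes the connection form there.
  have htriv : ∀ x ∈ c.outBdry, ∀ᶠ y in 𝓝 x, ∀ s v,
      Df.toFun s y v = BundleGlue.trivialD c.triv s y v := by
    intro x hx
    filter_upwards [hf.eq_zero x (Or.inr hx), c.triv.open_baseSet.mem_nhds
      (hc ▸ c.outBdry_subset hx)] with y hy hyc s v
    rw [hDf s y hyc v, BundleGlue.Connection.scaled, hy, zero_smul, add_zero]
  have htriv' : ∀ x ∈ c'.inBdry, ∀ᶠ y in 𝓝 x, ∀ s v,
      Df₂.toFun s y v = BundleGlue.trivialD c'.triv s y v := by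
    intro x hx
    filter_upwards [hf'.eq_zero x (Or.inl hx), c'.triv.open_baseSet.mem_nhds
      (hc' ▸ c'.inBdry_subset hx)] with y hy hyc s v
    rw [hDf₂ s y hyc v, BundleGlue.Connection.scaled, hy, zero_smul, add_zero]
  obtain ⟨DD, hDD, hDD'⟩ := BundleGlue.exists_glued_connection hl hr g.image_outBdry
    (fun x x' hxx' ↦ by
      obtain ⟨w, rfl, rfl⟩ := (g.inl_eq_inr_iff x x').1 hxx'
      exact ⟨⟨w, rfl⟩, ⟨w, rfl⟩⟩) g.range_union Df Df₂ htriv htriv'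
  refine ⟨DD, fun σ s x hσ v ↦ ?_, fun σ s x hσ v ↦ ?_⟩
  -- The section s agrees with the pullback of σ only near x; locality of `Df` makes this enough.
  · have hs : ∀ᶠ y in 𝓝 x, hl.pull σ y = s y := by
      filter_upwards [hσ] with y hy
      rw [← (g.fibl y).injective.eq_iff, hl.fib_pull, hy]
    rw [hDD, Df.congr_of_eventuallyEq hs]
    exact ⟨fun hx ↦ congrArg _ (hDf s x (hc ▸ hx) v), fun hx ↦ congrArg _ (hDf' s x (hc ▸ hx) v)⟩
  · have hs : ∀ᶠ y in 𝓝 x, hr.pull σ y = s y := by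
      filter_upwards [hσ] with y hy
      rw [← (g.fibr y).injective.eq_iff, hr.fib_pull, hy]
    rw [hDD', Df₂.congr_of_eventuallyEq hs]
    exact ⟨fun hx ↦ congrArg _ (hDf₂ s x (hc' ▸ hx) v),
      fun hx ↦ congrArg _ (hDf₂' s x (hc' ▸ hx) v)⟩
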